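/- All vector spaces are over $\mathbb{C}$. For a vector space $W$ put $\mathcal{E}(W)=\mathrm{Hom}(W,W((x)))$. For a polynomial $p$ or a rational function $f\in\mathbb{C}(x)$, $p(e^{z})$ and $f(e^{z})$ denote the elements of $\mathbb{C}((z))$ obtained by substitution. $\iota_{x_2,x_1}$ denotes expansion in $\mathbb{C}((x_2))((x_1))$ (nonnegative powers of $x_1$ in expansions of $(x_2-\lambda x_1)^n$), and in the delta functions below, as well as in $f_i(x_2-x_1)$, a power $(y-y')^n$ is expanded in nonnegative powers of the second variable $y'$. A weak quantum vertex algebra $(V,Y,\mathbf{1})$ is a vector space $V$ with a linear map $Y(\cdot,x):V\to\mathcal{E}(V)$ and a vector $\mathbf{1}\in V$ such that $Y(\mathbf{1},x)v=v$, $Y(v,x)\mathbf{1}\in V[[x]]$ and $\lim_{x\to0}Y(v,x)\mathbf{1}=v$ for all $v\in V$, and such that for all $u,v\in V$ there are finitely many $u^{(i)},v^{(i)}\in V$, $f_i\in\mathbb{C}((x))$ ($1\le i\le r$) with $$x_0^{-1}\delta\Big(\frac{x_1-x_2}{x_0}\Big)Y(u,x_1)Y(v,x_2)-x_0^{-1}\delta\Big(\frac{x_2-x_1}{-x_0}\Big)\sum_{i=1}^{r}f_i(x_2-x_1)Y(v^{(i)},x_2)Y(u^{(i)},x_1)=x_2^{-1}\delta\Big(\frac{x_1-x_0}{x_2}\Big)Y(Y(u,x_0)v,x_2).$$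 It is of T-type if for all $u,v\in V$ there are finitely many $u^{(i)},v^{(i)}\in V$, $f_i\in\mathbb{C}(x)$ and $k\in\mathbb{N}$ with $$(x_1-x_2)^kY(u,x_1)Y(v,x_2)=(x_1-x_2)^k\sum_{i}\iota_{x_2,x_1}\big(f_i(e^{x_1-x_2})\big)Y(v^{(i)},x_2)Y(u^{(i)},x_1).$$ A homomorphism of weak quantum vertex algebras is a linear map $g$ with $g(\mathbf{1})=\mathbf{1}$ and $g(Y(u,x)v)=Y(g(u),x)g(v)$ for all $u,v$. A $\phi$-coordinated quasi $V$-module is a vector space $W$ with a linear map $Y_W(\cdot,x):V\to\mathcal{E}(W)$ such that $Y_W(\mathbf{1},x)=1_W$ and for all $u,v\in V$ there is a nonzero polynomial $p$ with $p(x_1/x_2)Y_W(u,x_1)Y_W(v,x_2)\in\mathrm{Hom}(W,W((x_1,x_2)))$ and $$p(e^{z})Y_W(Y(u,z)v,x_2)=\big(p(x_1/x_2)Y_W(u,x_1)Y_W(v,x_2)\big)\big|_{x_1=x_2e^{z}}.$$ A subset $U\subseteq\mathcal{E}(W)$ is quasi $\mathcal{S}_{trig}$-local if for all $a(x),b(x)\in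 U$ there are finitely many $a^{(i)}(x),b^{(i)}(x)\in U$, $f_i\in\mathbb{C}(x)$ and a nonzero polynomial $p$ with $$p(x_1/x_2)a(x_1)b(x_2)=p(x_1/x_2)\sum_i\iota_{x_2,x_1}\big(f_i(x_2/x_1)\big)b^{(i)}(x_2)a^{(i)}(x_1).$$ If $a,b\in\mathcal{E}(W)$ and $p(x_1/x_2)a(x_1)b(x_2)\in\mathrm{Hom}(W,W((x_1,x_2)))$ for some nonzero polynomial $p$ (which is the case for any $a,b$ in a quasi $\mathcal{S}_{trig}$-local subset), set $$Y_{\mathcal{E}}^{e}(a(x),z)b(x)=p(e^{z})^{-1}\big(p(x_1/x)a(x_1)b(x)\big)\big|_{x_1=xe^{z}},$$ which does not depend on the choice of $p$. **Proposition.** Let $V$ be a T-type weak quantum vertex algebra and let $(W,Y_W)$ be a $\phi$-coordinated quasi $V$-module. Set $V_W=\{Y_W(v,x)\mid v\in V\}$. Then $V_W$ is a quasi $\mathcal{S}_{trig}$-local subspace of $\mathcal{E}(W)$; $V_W$ contains $1_W$, is closed under the coefficients of $Y_{\mathcal{E}}^{e}$, and $(V_W,Y_{\mathcal{E}}^{e},1_W)$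 is a weak quantum vertex algebra; and $v\mapsto Y_W(v,x)$ is a homomorphism of weak quantum vertex algebras from $V$ to $V_W$. -/

import Mathlib

noncomputable section

namespace QVA

/-! ## Laurent series and fields -/

/-- `W((z))`, the space of lower truncated formal Laurent series with coefficients in `W`; it is a
module over the field `ℂ((z))`. -/
abbrev Laurent (W : Type*) [AddCommGroup W] [Module ℂ W] := HahnModule ℤ ℂ W

/-- The space `𝓔(W) = Hom(W, W((x)))`. -/
abbrev Fields (W : Type*) [AddCommGroup W] [Module ℂ W] := VertexOperator ℂ W

section

variable {U V W : Type*} [AddCommGroup U] [Module ℂ U] [AddCommGroup V] [Module ℂ V]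
  [AddCommGroup W] [Module ℂ W]

/-- The coefficient of `z ^ n`. -/
def Laurent.coeff (A : Laurent W) (n : ℤ) : W := ((HahnModule.of ℂ).symm A).coeff n

/-- Applying a linear map to every coefficient, `U((z)) → V((z))`. -/
def Laurent.map (g : U →ₗ[ℂ] V) (A : Laurent U) : Laurent V :=
  HahnModule.of ℂ (((HahnModule.of ℂ).symm A).map g)

theorem Laurent.ext {A B : Laurent W} (h : ∀ n, A.coeff n = B.coeff n) : A = B :=
  HahnModule.ext _ _ (funext h)

/-- The identity operator `1_W`, as a constant series in `𝓔(W)`. -/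
def idField (W : Type*) [AddCommGroup W] [Module ℂ W] : Fields W :=
  VertexOperator.of_coeff (fun n => if n = 0 then LinearMap.id else 0) fun w =>
    ⟨0, fun n hn => by
      by_contra h
      exact hn (by simp [show n ≠ 0 by omega])⟩

/-! ## Series in two variables

An element `A` of `ℤ → ℤ → W` is the formal series `∑ A m n x₁ ^ m x₂ ^ n` in
`W[[x₁, x₁⁻¹, x₂, x₂⁻¹]]`. -/

/-- Multiplication by `x₁`. -/
def mulX₁ : Module.End ℂ (ℤ → ℤ → W) where
  toFun A := fun m n => A (m - 1) n
  map_add' _ _ := rfl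
  map_smul' _ _ := rfl

/-- Multiplication by `x₂`. -/
def mulX₂ : Module.End ℂ (ℤ → ℤ → W) where
  toFun A := fun m n => A m (n - 1)
  map_add' _ _ := rfl
  map_smul' _ _ := rfl

/-- Multiplication by `x₁ / x₂`. -/
def mulRatio : Module.End ℂ (ℤ → ℤ → W) where
  toFun A := fun m n => A (m - 1) (n + 1)
  map_add' _ _ := rfl
  map_smul' _ _ := rfl

/-- Multiplication by `(x₁ - x₂) ^ k` for a nonnegative integer `k`. -/
def mulDiffPow (k : ℕ) : Module.End ℂ (ℤ → ℤ → W) := (mulX₁ - mulX₂) ^ k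

/-- Multiplication by `p(x₁ / x₂)` for a polynomial `p`. -/
def mulPoly (p : Polynomial ℂ) : Module.End ℂ (ℤ → ℤ → W) := Polynomial.aeval mulRatio p

/-- Exchange of the names of the two variables. -/
def swap (A : ℤ → ℤ → W) : ℤ → ℤ → W := fun m n => A n m

/-- The product of a scalar series and a `W`-valued series in the same two variables. Below it
occurs only where every coefficient of the product is a finite sum. -/
def mulSeries (c : ℤ → ℤ → ℂ) (A : ℤ → ℤ → W) : ℤ → ℤ → W := fun m n =>
  ∑ᶠ s : ℤ × ℤ, c s.1 s.2 • A (m - s.1) (n - s.2)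

/-- For `f(x) = ∑ f_k x ^ k ∈ ℂ((x))`, the expansion of `f(x₁ - x₂)` in nonnegative powers of `x₂`:
since `(x₁ - x₂) ^ k = ∑_{t ≥ 0} binom(k, t) (-1) ^ t x₁ ^ (k - t) x₂ ^ t`, the coefficient of
`x₁ ^ s x₂ ^ t` is `f_{s + t} binom(s + t, t) (-1) ^ t` for `t ≥ 0`. -/
def iotaDiff (f : LaurentSeries ℂ) : ℤ → ℤ → ℂ := fun s t =>
  if 0 ≤ t then f.coeff (s + t) * ((Ring.choose (s + t) t.toNat : ℤ) : ℂ) * (-1) ^ t.toNat else 0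

/-- For `f(x) = ∑ f_k x ^ k ∈ ℂ((x))`, the series `f(x₁ / x₂) = ∑ f_k x₁ ^ k x₂ ^ (-k)`. -/
def ratioSeries (f : LaurentSeries ℂ) : ℤ → ℤ → ℂ := fun s t => if s + t = 0 then f.coeff s else 0

/-- `a(x₁) b(x₂) w`, linear in `w`. -/
def prodSeries (a b : Fields W) : W →ₗ[ℂ] (ℤ → ℤ → W) where
  toFun w := fun m n => HVertexOperator.coeff a m (HVertexOperator.coeff b n w)
  map_add' v w := by funext m n; simp only [map_add, Pi.add_apply]
  map_smul' c w := by funext m n; simp only [map_smul, Pi.smul_apply, RingHom.id_apply]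

/-! ## Exponential substitutions -/

/-- `e ^ x ∈ ℂ((x))`. -/
def expL : LaurentSeries ℂ := HahnSeries.ofPowerSeries ℤ ℂ (PowerSeries.exp ℂ)

/-- `e ^ (-x) ∈ ℂ((x))`. -/
def expNegL : LaurentSeries ℂ :=
  HahnSeries.ofPowerSeries ℤ ℂ (PowerSeries.rescale (-1 : ℂ) (PowerSeries.exp ℂ))

/-- `p(e ^ z) ∈ ℂ((z))` for a polynomial `p`. -/
def polyExp (p : Polynomial ℂ) : LaurentSeries ℂ := p.eval₂ HahnSeries.C expL

/-- `g(y) ∈ ℂ((x))` for a rational function `g` and `y ∈ ℂ((x))`: the quotient of the values at `y`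
of the numerator and of the denominator of `g`. -/
def ratSubst (g : RatFunc ℂ) (y : LaurentSeries ℂ) : LaurentSeries ℂ :=
  RatFunc.eval (HahnSeries.C : ℂ →+* LaurentSeries ℂ) y g

/-- For a rational function `f`, the expansion `ι_{x₁,x₂} f(e ^ (x₂ - x₁))`, in nonnegative powers
of `x₂`: the series `h(x₁ - x₂)` with `h(x) = f(e ^ (-x)) ∈ ℂ((x))`. -/
def iotaExp (f : RatFunc ℂ) : ℤ → ℤ → ℂ := iotaDiff (ratSubst f expNegL)

/-- For a rational function `f`, the expansion `ι_{x₂,x₁} f(x₂ / x₁)`, in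
`ℂ((x₂))((x₁))`: the series `h(x₁ / x₂)` with `h(x) = f(x⁻¹) ∈ ℂ((x))`. -/
def iotaRatio (f : RatFunc ℂ) : ℤ → ℤ → ℂ := ratioSeries (ratSubst f (HahnSeries.single (-1) 1))

/-- `W((x₁, x₂)) = W[[x₁, x₂]][x₁⁻¹, x₂⁻¹]`. -/
def DoubleLaurent (W : Type*) [AddCommGroup W] [Module ℂ W] : Submodule ℂ (ℤ → ℤ → W) where
  carrier := {A | ∃ N : ℤ, ∀ m n, m < N ∨ n < N → A m n = 0}
  zero_mem' := ⟨0, fun _ _ _ => rfl⟩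
  add_mem' := by
    rintro A B ⟨N, hN⟩ ⟨M, hM⟩
    refine ⟨min N M, fun m n h => ?_⟩
    rw [Pi.add_apply, Pi.add_apply, hN m n (by omega), hM m n (by omega), add_zero]
  smul_mem' := by
    rintro c A ⟨N, hN⟩
    exact ⟨N, fun m n h => by rw [Pi.smul_apply, Pi.smul_apply, hN m n h, smul_zero]⟩

theorem DoubleLaurent.finite_support {A : ℤ → ℤ → W} (hA : A ∈ DoubleLaurent W) (c : ℤ → ℂ)
    (k : ℤ) : (Function.support fun m : ℤ => c m • A m (k - m)).Finite := by
  obtain ⟨N, hN⟩ := hA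
  refine (Set.finite_Icc N (k - N)).subset fun m hm => ?_
  by_contra h
  refine hm ?_
  change c m • A m (k - m) = 0
  rw [hN m (k - m), smul_zero]
  rw [Set.mem_Icc] at h
  omega

/-- The coefficient of `z ^ j` in `A(x₂ e ^ z, x₂) = ∑ A m n e ^ (m z) x₂ ^ (m + n)`, for
`A ∈ W((x₁, x₂))`: the coefficient of `x₂ ^ k` in it is `∑_m (m ^ j / j!) A m (k - m)`. -/
def expSubstCoeff (j : ℕ) : DoubleLaurent W →ₗ[ℂ] Laurent W where
  toFun A := HahnModule.of ℂ <| HahnSeries.ofSuppBddBelow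
    (fun k : ℤ => ∑ᶠ m : ℤ, ((m : ℂ) ^ j / (j.factorial : ℂ)) • A.1 m (k - m)) (by
      obtain ⟨N, hN⟩ := A.2
      refine ⟨N + N, fun k hk => ?_⟩
      by_contra h
      refine hk (finsum_eq_zero_of_forall_eq_zero fun m => ?_)
      rw [hN m (k - m) (by omega), smul_zero])
  map_add' A B := by
    refine Laurent.ext fun k => ?_
    refine (finsum_congr fun m => ?_).trans (finsum_add_distrib
      (DoubleLaurent.finite_support A.2 _ k) (DoubleLaurent.finite_support B.2 _ k))
    exact smul_add _ _ _
  map_smul' c A := by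
    refine Laurent.ext fun k => ?_
    refine (finsum_congr fun m => ?_).trans
      (smul_finsum' c (DoubleLaurent.finite_support A.2 _ k)).symm
    exact smul_comm _ _ _

/-- For `B(x₁, x₂) ∈ Hom(W, W((x₁, x₂)))`, the series `B(x₁, x₂)|_{x₁ = x₂ e ^ z}`, as a power
series in `z` with coefficients in `𝓔(W)` (with variable `x₂`). -/
def expSubst (B : W →ₗ[ℂ] DoubleLaurent W) : Laurent (Fields W) :=
  HahnModule.of ℂ <| HahnSeries.ofSuppBddBelow
    (fun i : ℤ => if 0 ≤ i then (expSubstCoeff i.toNat).comp B else 0)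
    ⟨0, fun i hi => by
      by_contra h
      exact hi (if_neg h)⟩

/-- `p(x₁ / x₂) a(x₁) b(x₂) ∈ Hom(W, W((x₁, x₂)))`. -/
def QuasiCompatible (p : Polynomial ℂ) (a b : Fields W) : Prop :=
  ∀ w, mulPoly p (prodSeries a b w) ∈ DoubleLaurent W

/-- `p(x₁ / x₂) a(x₁) b(x₂)` as an element of `Hom(W, W((x₁, x₂)))`. -/
def quasiProd (p : Polynomial ℂ) (a b : Fields W) (h : QuasiCompatible p a b) :
    W →ₗ[ℂ] DoubleLaurent W :=
  ((mulPoly p).comp (prodSeries a b)).codRestrict (DoubleLaurent W) h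

open Classical in
/-- `Y_𝓔^e(a(x), z) b(x) = p(e ^ z)⁻¹ (p(x₁ / x) a(x₁) b(x))|_{x₁ = x e ^ z}` for a nonzero
polynomial `p` with `p(x₁ / x) a(x₁) b(x) ∈ Hom(W, W((x₁, x)))`; it does not depend on `p`, see
`YE_eq`. (If there is no such `p`, the value is set to `0`.) The coefficient of `z ^ (-n - 1)` is
`a(x)_n^e b(x)`. -/
def YE (a b : Fields W) : Laurent (Fields W) :=
  if h : ∃ p : Polynomial ℂ, p ≠ 0 ∧ QuasiCompatible p a b then
    (polyExp h.choose)⁻¹ • expSubst (quasiProd h.choose a b h.choose_spec.2)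
  else 0

/-! ### Independence of the polynomial -/

theorem laurent_mul_smul (f g : LaurentSeries ℂ) (A : Laurent W) :
    (f * g) • A = f • (g • A) :=
  mul_smul f g A

theorem mulRatio_mem {A : ℤ → ℤ → W} (hA : A ∈ DoubleLaurent W) :
    mulRatio A ∈ DoubleLaurent W := by
  obtain ⟨N, hN⟩ := hA
  exact ⟨N - 1, fun m n h => hN _ _ (by omega)⟩

theorem mulPoly_mem (p : Polynomial ℂ) :
    ∀ A ∈ DoubleLaurent W, mulPoly p A ∈ DoubleLaurent W := by
  induction p using Polynomial.induction_on with
  | C c =>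
    intro A hA
    simpa [mulPoly, Algebra.algebraMap_eq_smul_one] using (DoubleLaurent W).smul_mem c hA
  | add p q hp hq =>
    intro A hA
    simpa [mulPoly] using (DoubleLaurent W).add_mem (hp A hA) (hq A hA)
  | monomial n c h =>
    intro A hA
    rw [pow_succ, ← mul_assoc]
    simpa [mulPoly] using h _ (mulRatio_mem hA)

theorem expSubst_coeff_of_nonneg (B : W →ₗ[ℂ] DoubleLaurent W) (n : ℕ) :
    Laurent.coeff (expSubst B) n = (expSubstCoeff n).comp B := by
  change (if 0 ≤ (n : ℤ) then (expSubstCoeff (n : ℤ).toNat).comp B else 0) = _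
  rw [if_pos (by omega), Int.toNat_natCast]

theorem expSubst_coeff_of_neg (B : W →ₗ[ℂ] DoubleLaurent W) {n : ℤ} (hn : n < 0) :
    Laurent.coeff (expSubst B) n = 0 :=
  if_neg (by omega)

theorem expSubst_ext {B : W →ₗ[ℂ] DoubleLaurent W} {F : Laurent (Fields W)}
    (h₁ : ∀ n : ℤ, n < 0 → F.coeff n = 0)
    (h₂ : ∀ n : ℕ, F.coeff n = (expSubstCoeff n).comp B) : expSubst B = F := by
  refine Laurent.ext fun n => ?_
  rcases lt_or_ge n 0 with hn | hn
  · rw [expSubst_coeff_of_neg B hn, h₁ n hn]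
  · lift n to ℕ using hn
    rw [expSubst_coeff_of_nonneg, h₂]

theorem coeff_smul_powerSeries (f : PowerSeries ℂ) (y : Laurent V)
    (hy : ∀ n : ℤ, n < 0 → y.coeff n = 0) :
    (∀ n : ℤ, n < 0 → Laurent.coeff (HahnSeries.ofPowerSeries ℤ ℂ f • y) n = 0) ∧
    ∀ n : ℕ, Laurent.coeff (HahnSeries.ofPowerSeries ℤ ℂ f • y) n =
      ∑ ij ∈ Finset.HasAntidiagonal.antidiagonal n, PowerSeries.coeff ij.1 f • y.coeff ij.2 := by
  have hf : ∀ n : ℤ, n < 0 → (HahnSeries.ofPowerSeries ℤ ℂ f).coeff n = 0 := by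
    intro n hn
    rw [HahnSeries.ofPowerSeries_apply, HahnSeries.embDomain_of_notMem_range]
    rintro ⟨m, hm⟩
    have : (m : ℤ) = n := hm
    omega
  constructor
  · intro n hn
    change ((HahnModule.of ℂ).symm _).coeff n = 0
    rw [HahnModule.coeff_smul]
    refine Finset.sum_eq_zero fun ij hij => ?_
    have h := ((Finset.mem_vaddAntidiagonal _ _).1 hij).2.2
    rw [vadd_eq_add] at h
    rcases lt_or_ge ij.1 0 with h1 | h1
    · rw [hf _ h1, zero_smul]
    · have : ((HahnModule.of ℂ).symm y).coeff ij.2 = 0 := hy ij.2 (by omega)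
      rw [this, smul_zero]
  · intro n
    change ((HahnModule.of ℂ).symm _).coeff (n : ℤ) = _
    rw [HahnModule.coeff_smul]
    symm
    refine Finset.sum_bij_ne_zero (fun ij _ _ => ((ij.1 : ℤ), (ij.2 : ℤ))) ?_ ?_ ?_ ?_
    · intro ij hij h0
      rw [Finset.mem_vaddAntidiagonal]
      have h := Finset.HasAntidiagonal.mem_antidiagonal.1 hij
      refine ⟨?_, ?_, ?_⟩
      · intro h1
        refine h0 ?_
        rw [HahnSeries.ofPowerSeries_apply_coeff] at h1
        rw [h1, zero_smul]
      · intro h1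
        refine h0 ?_
        have : y.coeff ij.2 = 0 := h1
        rw [this, smul_zero]
      · change (ij.1 : ℤ) + (ij.2 : ℤ) = n
        omega
    · intro a _ _ b _ _ hab
      simp only [Prod.mk.injEq, Nat.cast_inj] at hab
      exact Prod.ext hab.1 hab.2
    · rintro ⟨i, j⟩ hij h0
      have h := ((Finset.mem_vaddAntidiagonal _ _).1 hij).2.2
      have h : i + j = n := h
      have hi : 0 ≤ i := by
        by_contra hi
        exact h0 (by rw [hf i (by omega), zero_smul])
      have hj : 0 ≤ j := by
        by_contra hj
        refine h0 ?_
        have : ((HahnModule.of ℂ).symm y).coeff j = 0 := hy j (by omega)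
        rw [this, smul_zero]
      lift i to ℕ using hi
      lift j to ℕ using hj
      refine ⟨(i, j), Finset.HasAntidiagonal.mem_antidiagonal.2 (by omega), ?_, rfl⟩
      rw [HahnSeries.ofPowerSeries_apply_coeff] at h0
      exact h0
    · intro ij _ _
      rw [HahnSeries.ofPowerSeries_apply_coeff]
      rfl

/-- Multiplication of `A(x₁, x₂)` by `x₁ / x₂` becomes multiplication by `e ^ z`. -/
theorem expSubstCoeff_mulRatio (A : DoubleLaurent W) (j : ℕ) :
    expSubstCoeff j ⟨mulRatio A.1, mulRatio_mem A.2⟩ =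
      ∑ il ∈ Finset.HasAntidiagonal.antidiagonal j, PowerSeries.coeff il.1 (PowerSeries.exp ℂ) •
        expSubstCoeff il.2 A := by
  have hsum : ∀ (s : Finset (ℕ × ℕ)) (g : ℕ × ℕ → Laurent W) (k : ℤ),
      Laurent.coeff (∑ il ∈ s, g il) k = ∑ il ∈ s, Laurent.coeff (g il) k := by
    intro s g k
    induction s using Finset.cons_induction with
    | empty => rfl
    | cons a s ha ih =>
      rw [Finset.sum_cons, Finset.sum_cons, ← ih]
      rfl
  refine Laurent.ext fun k => ?_
  rw [hsum]
  change (∑ᶠ m : ℤ, ((m : ℂ) ^ j / (j.factorial : ℂ)) • A.1 (m - 1) (k - m + 1)) =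
    ∑ il ∈ Finset.HasAntidiagonal.antidiagonal j, PowerSeries.coeff il.1 (PowerSeries.exp ℂ) •
      ∑ᶠ m : ℤ, ((m : ℂ) ^ il.2 / (il.2.factorial : ℂ)) • A.1 m (k - m)
  rw [← finsum_comp_equiv (Equiv.addRight (1 : ℤ))]
  simp_rw [smul_finsum' _ (DoubleLaurent.finite_support A.2 _ k)]
  rw [← finsum_sum_comm]
  · refine finsum_congr fun m => ?_
    simp_rw [smul_smul]
    rw [← Finset.sum_smul]
    have e1 : (Equiv.addRight (1 : ℤ)) m - 1 = m := by simp
    have e2 : k - (Equiv.addRight (1 : ℤ)) m + 1 = k - m := by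
      simp only [Equiv.coe_addRight]
      ring
    rw [e1, e2]
    congr 1
    simp only [Equiv.coe_addRight, Int.cast_add, Int.cast_one]
    rw [add_comm (m : ℂ) 1, (Commute.all (1 : ℂ) (m : ℂ)).add_pow', Finset.sum_div]
    refine Finset.sum_congr rfl fun il hil => ?_
    have hil := Finset.HasAntidiagonal.mem_antidiagonal.1 hil
    have h1 := Nat.add_choose_mul_factorial_mul_factorial il.1 il.2
    rw [← Nat.choose_symm_add, hil] at h1
    have h2 : ((j.choose il.1 : ℕ) : ℂ) * (il.1.factorial : ℂ) * (il.2.factorial : ℂ) =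
        (j.factorial : ℂ) := by exact_mod_cast h1
    have h3 : (il.1.factorial : ℂ) ≠ 0 := by exact_mod_cast il.1.factorial_ne_zero
    have h4 : (il.2.factorial : ℂ) ≠ 0 := by exact_mod_cast il.2.factorial_ne_zero
    have h5 : (j.factorial : ℂ) ≠ 0 := by exact_mod_cast j.factorial_ne_zero
    rw [PowerSeries.coeff_exp, nsmul_eq_mul, one_pow, one_mul]
    simp only [one_div, map_inv₀, map_natCast]
    rw [← h2]
    rw [← h2] at h5
    have h6 : ((j.choose il.1 : ℕ) : ℂ) ≠ 0 := fun h => h5 (by rw [h, zero_mul, zero_mul])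
    field_simp
  · intro il _
    simp_rw [smul_smul]
    exact DoubleLaurent.finite_support A.2 _ k

theorem expSubst_mulPoly (p : Polynomial ℂ) : ∀ (B B' : W →ₗ[ℂ] DoubleLaurent W),
    (∀ w, (B' w).1 = mulPoly p (B w).1) → expSubst B' = polyExp p • expSubst B := by
  induction p using Polynomial.induction_on with
  | C c =>
    intro B B' h
    have hB : B' = c • B := by
      refine LinearMap.ext fun w => Subtype.ext ?_
      rw [h w]
      simp [mulPoly, Algebra.algebraMap_eq_smul_one]
    have hc : polyExp (Polynomial.C c) = HahnSeries.single 0 c := by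
      rw [polyExp, Polynomial.eval₂_C, HahnSeries.C_apply]
    rw [hc, HahnModule.single_zero_smul_eq_smul]
    refine expSubst_ext (fun n hn => ?_) fun n => ?_
    · change c • Laurent.coeff (expSubst B) n = 0
      rw [expSubst_coeff_of_neg B hn, smul_zero]
    · change c • Laurent.coeff (expSubst B) n = _
      rw [expSubst_coeff_of_nonneg, hB, LinearMap.comp_smul]
  | add p q hp hq =>
    intro B B' h
    let P : W →ₗ[ℂ] DoubleLaurent W :=
      ((mulPoly p).comp ((DoubleLaurent W).subtype.comp B)).codRestrict _
        fun w => mulPoly_mem p _ (B w).2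
    let Q : W →ₗ[ℂ] DoubleLaurent W :=
      ((mulPoly q).comp ((DoubleLaurent W).subtype.comp B)).codRestrict _
        fun w => mulPoly_mem q _ (B w).2
    have hB : B' = P + Q := by
      refine LinearMap.ext fun w => Subtype.ext ?_
      rw [h w]
      simp [mulPoly, P, Q]
    have hc : polyExp (p + q) = polyExp p + polyExp q := Polynomial.eval₂_add _ _
    rw [hc, add_smul, ← hp B P fun w => rfl, ← hq B Q fun w => rfl]
    refine expSubst_ext (fun n hn => ?_) fun n => ?_
    · change Laurent.coeff (expSubst P) n + Laurent.coeff (expSubst Q) n = 0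
      rw [expSubst_coeff_of_neg _ hn, expSubst_coeff_of_neg _ hn, add_zero]
    · change Laurent.coeff (expSubst P) n + Laurent.coeff (expSubst Q) n = _
      rw [expSubst_coeff_of_nonneg, expSubst_coeff_of_nonneg, hB, LinearMap.comp_add]
  | monomial n c ih =>
    intro B B' h
    let P : W →ₗ[ℂ] DoubleLaurent W :=
      (mulRatio.comp ((DoubleLaurent W).subtype.comp B)).codRestrict _
        fun w => mulRatio_mem (B w).2
    have hP : expSubst P = expL • expSubst B := by
      obtain ⟨h1, h2⟩ := coeff_smul_powerSeries (PowerSeries.exp ℂ) (expSubst B)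
        fun n hn => expSubst_coeff_of_neg B hn
      refine expSubst_ext h1 fun j => (h2 j).trans ?_
      refine LinearMap.ext fun w => ?_
      rw [LinearMap.sum_apply]
      refine Eq.trans ?_ (expSubstCoeff_mulRatio (B w) j).symm
      refine Finset.sum_congr rfl fun il _ => ?_
      rw [expSubst_coeff_of_nonneg]
      rfl
    have hc : polyExp (Polynomial.C c * Polynomial.X ^ (n + 1)) =
        polyExp (Polynomial.C c * Polynomial.X ^ n) * expL := by
      rw [pow_succ, ← mul_assoc, polyExp, Polynomial.eval₂_mul_X]
      rfl
    rw [hc, laurent_mul_smul, ← hP]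
    refine ih P B' fun w => ?_
    rw [h w, pow_succ, ← mul_assoc]
    simp only [mulPoly, map_mul, Polynomial.aeval_X]
    rfl

/-- `p(e ^ z) ≠ 0` for a nonzero polynomial `p`. -/
theorem polyExp_ne_zero {p : Polynomial ℂ} (hp : p ≠ 0) : polyExp p ≠ 0 := by
  intro h0
  have h1 : polyExp p =
      HahnSeries.ofPowerSeries ℤ ℂ (p.eval₂ PowerSeries.C (PowerSeries.exp ℂ)) := by
    rw [Polynomial.hom_eval₂]
    refine congrArg₂ (fun f x => Polynomial.eval₂ f x p) (RingHom.ext fun c => ?_) rfl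
    exact (HahnSeries.ofPowerSeries_C c).symm
  have h2 : p.eval₂ PowerSeries.C (PowerSeries.exp ℂ) = 0 := by
    refine HahnSeries.ofPowerSeries_injective (Γ := ℤ) ?_
    rw [← h1, h0, map_zero]
  have h3 : ∀ j : ℕ, p.sum (fun m c => c * (m : ℂ) ^ j) = 0 := by
    intro j
    have h := congrArg (PowerSeries.coeff j) h2
    rw [Polynomial.eval₂_eq_sum, Polynomial.sum, map_sum, map_zero] at h
    simp only [PowerSeries.exp_pow_eq_rescale_exp, PowerSeries.coeff_C_mul,
      PowerSeries.coeff_rescale, PowerSeries.coeff_exp] at h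
    simp only [← mul_assoc] at h
    rw [← Finset.sum_mul] at h
    refine (mul_eq_zero.1 h).resolve_right ?_
    simp [Nat.factorial_ne_zero]
  have h4 : ∀ q : Polynomial ℂ, p.sum (fun m c => c * q.eval (m : ℂ)) = 0 := by
    intro q
    induction q using Polynomial.induction_on' with
    | add q r hq hr =>
      simp only [Polynomial.sum, Polynomial.eval_add, mul_add, Finset.sum_add_distrib] at hq hr ⊢
      rw [hq, hr, add_zero]
    | monomial n a =>
      have h := congrArg (a * ·) (h3 n)
      simp only [Polynomial.sum, Polynomial.eval_monomial, Finset.mul_sum, mul_zero] at h ⊢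
      rw [← h]
      exact Finset.sum_congr rfl fun m _ => by ring
  obtain ⟨m, hm⟩ := Polynomial.support_nonempty.2 hp
  have h5 := h4 (∏ i ∈ p.support.erase m, (Polynomial.X - Polynomial.C (i : ℂ)))
  rw [Polynomial.sum, Finset.sum_eq_single_of_mem m hm] at h5
  · rw [Polynomial.eval_prod] at h5
    rcases mul_eq_zero.1 h5 with h | h
    · exact Polynomial.mem_support_iff.1 hm h
    · obtain ⟨i, hi, hi'⟩ := Finset.prod_eq_zero_iff.1 h
      rw [Polynomial.eval_sub, Polynomial.eval_X, Polynomial.eval_C, sub_eq_zero, Nat.cast_inj]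
        at hi'
      exact (Finset.mem_erase.1 hi).1 hi'.symm
  · intro i hi him
    rw [Polynomial.eval_prod, Finset.prod_eq_zero (Finset.mem_erase.2 ⟨him, hi⟩), mul_zero]
    rw [Polynomial.eval_sub, Polynomial.eval_X, Polynomial.eval_C, sub_self]

theorem YE_eq (a b : Fields W) (p : Polynomial ℂ) (hp : p ≠ 0) (h : QuasiCompatible p a b) :
    YE a b = (polyExp p)⁻¹ • expSubst (quasiProd p a b h) := by
  have hex : ∃ p : Polynomial ℂ, p ≠ 0 ∧ QuasiCompatible p a b := ⟨p, hp, h⟩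
  rw [YE, dif_pos hex]
  set q := hex.choose with hq
  have hq0 : q ≠ 0 := hex.choose_spec.1
  have hqc : QuasiCompatible q a b := hex.choose_spec.2
  have hpq : QuasiCompatible (q * p) a b := fun w => by
    simpa [mulPoly] using mulPoly_mem q _ (h w)
  have e1 := expSubst_mulPoly q (quasiProd p a b h) (quasiProd (q * p) a b hpq) fun w => by
    change mulPoly (q * p) _ = mulPoly q (mulPoly p _)
    simp [mulPoly]
  have e2 := expSubst_mulPoly p (quasiProd q a b hqc) (quasiProd (q * p) a b hpq) fun w => by
    change mulPoly (q * p) _ = mulPoly p (mulPoly q _)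
    rw [mul_comm]
    simp [mulPoly]
  have e3 : polyExp q • expSubst (quasiProd p a b h) = polyExp p • expSubst (quasiProd q a b hqc) :=
    e1.symm.trans e2
  have hp' := polyExp_ne_zero hp
  have hq' := polyExp_ne_zero hq0
  calc (polyExp q)⁻¹ • expSubst (quasiProd q a b hqc)
      = ((polyExp q)⁻¹ * (polyExp p)⁻¹) • (polyExp p • expSubst (quasiProd q a b hqc)) := by
        rw [← laurent_mul_smul, mul_assoc, inv_mul_cancel₀ hp', mul_one]
    _ = (polyExp p)⁻¹ • expSubst (quasiProd p a b h) := by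
        rw [← e3, ← laurent_mul_smul, mul_comm (polyExp q)⁻¹, mul_assoc, inv_mul_cancel₀ hq', mul_one]

end

/-! ## Weak quantum vertex algebras -/

section

variable {V : Type*} [AddCommGroup V] [Module ℂ V]

/-- The `𝒮`-Jacobi identity
`x₀⁻¹ δ((x₁ - x₂) / x₀) Y(u, x₁) Y(v, x₂)`
`- x₀⁻¹ δ((x₂ - x₁) / (-x₀)) ∑ i, f_i(x₂ - x₁) Y(v_i, x₂) Y(u_i, x₁)`
`= x₂⁻¹ δ((x₁ - x₀) / x₂) Y(Y(u, x₀) v, x₂)`.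
Here `x₀⁻¹ δ((x₁ - x₂) / x₀) = ∑ n, x₀ ^ (-n - 1) (x₁ - x₂) ^ n`, expanded in nonnegative powers of
`x₂`, `x₀⁻¹ δ((x₂ - x₁) / (-x₀)) = ∑ n, (-1) ^ n x₀ ^ (-n - 1) (x₂ - x₁) ^ n`, expanded in nonnegative
powers of `x₁`, and `x₂⁻¹ δ((x₁ - x₀) / x₂) = ∑ k, x₂ ^ (-k - 1) (x₁ - x₀) ^ k`, expanded in
nonnegative powers of `x₀`. The identity is applied to `w`, and the coefficients of
`x₀ ^ (-n - 1) x₁ ^ p x₂ ^ q` are compared; the index `s = (k, i)` on the right refers to the term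
in `x₀ ^ i x₁ ^ p` of `(x₁ - x₀) ^ k`. -/
def SJacobi (Y : V →ₗ[ℂ] Fields V) (u v : V) {r : ℕ} (u' v' : Fin r → V)
    (f : Fin r → LaurentSeries ℂ) : Prop :=
  ∀ (w : V) (n p q : ℤ),
    mulSeries (iotaDiff (HahnSeries.single n 1)) (prodSeries (Y u) (Y v) w) p q
      - (-1 : ℂ) ^ n • mulSeries (iotaDiff (HahnSeries.single n 1))
          (∑ i, mulSeries (iotaDiff (f i)) (prodSeries (Y (v' i)) (Y (u' i)) w)) q p
    = ∑ᶠ s : ℤ × ℤ, iotaDiff (HahnSeries.single s.1 1) p s.2 •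
        HVertexOperator.coeff (Y (Laurent.coeff (Y u v) (-n - 1 - s.2))) (q + s.1 + 1) w

end

/-- Weak quantum vertex algebra structures on a vector space `V`. -/
structure WeakQVA (V : Type*) [AddCommGroup V] [Module ℂ V] where
  /-- The vertex operator map `v ↦ Y(v, x)`. -/
  Y : V →ₗ[ℂ] Fields V
  /-- The vacuum vector. -/
  vac : V
  vac_left : ∀ v, Y vac v = HahnModule.of ℂ (HahnSeries.single 0 v)
  /-- `Y(v, x) 1 ∈ V[[x]]`. -/
  creation : ∀ v, ∀ n < 0, Laurent.coeff (Y v vac) n = 0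
  /-- `lim_{x → 0} Y(v, x) 1 = v`. -/
  creation_lim : ∀ v, Laurent.coeff (Y v vac) 0 = v
  jacobi : ∀ u v, ∃ (r : ℕ) (u' v' : Fin r → V) (f : Fin r → LaurentSeries ℂ),
    SJacobi Y u v u' v' f

section

variable {U V : Type*} [AddCommGroup U] [Module ℂ U] [AddCommGroup V] [Module ℂ V]

/-- Weak quantum vertex algebras of T-type: for any `u`, `v` there are `u_i`, `v_i`, rational
functions `f_i` and `k ≥ 0` with `(x₁ - x₂) ^ k Y(u, x₁) Y(v, x₂) =`
`(x₁ - x₂) ^ k ∑ i, ι_{x₂,x₁}(f_i(e ^ (x₁ - x₂))) Y(v_i, x₂) Y(u_i, x₁)`. -/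
def WeakQVA.IsTType (A : WeakQVA V) : Prop :=
  ∀ u v, ∃ (r : ℕ) (u' v' : Fin r → V) (f : Fin r → RatFunc ℂ) (k : ℕ), ∀ w,
    mulDiffPow k (prodSeries (A.Y u) (A.Y v) w) =
      mulDiffPow k (swap (∑ i, mulSeries (iotaExp (f i)) (prodSeries (A.Y (v' i)) (A.Y (u' i)) w)))

/-- Homomorphisms of weak quantum vertex algebras: linear maps `g` with `g 1 = 1` and
`g (Y(u, x) v) = Y(g u, x) (g v)`. -/
def WeakQVA.IsHom (A : WeakQVA U) (B : WeakQVA V) (g : U →ₗ[ℂ] V) : Prop :=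
  g A.vac = B.vac ∧ ∀ u v, Laurent.map g (A.Y u v) = B.Y (g u) (g v)

end

/-- `φ`-coordinated quasi module structures on a vector space `W` over the weak quantum vertex
algebra `A`. -/
structure PhiQuasiModule {V : Type*} [AddCommGroup V] [Module ℂ V] (A : WeakQVA V)
    (W : Type*) [AddCommGroup W] [Module ℂ W] where
  /-- The map `v ↦ Y_W(v, x)`. -/
  YW : V →ₗ[ℂ] Fields W
  YW_vac : YW A.vac = idField W
  /-- `p(x₁ / x₂) Y_W(u, x₁) Y_W(v, x₂) ∈ Hom(W, W((x₁, x₂)))` and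
  `p(e ^ z) Y_W(Y(u, z) v, x₂) = (p(x₁ / x₂) Y_W(u, x₁) Y_W(v, x₂))|_{x₁ = x₂ e ^ z}`. -/
  assoc : ∀ u v, ∃ p : Polynomial ℂ, p ≠ 0 ∧ ∃ h : QuasiCompatible p (YW u) (YW v),
    polyExp p • Laurent.map YW (A.Y u v) = expSubst (quasiProd p (YW u) (YW v) h)

/-- The subspace `V_W = {Y_W(v, x) | v ∈ V}` of `𝓔(W)`. -/
abbrev PhiQuasiModule.fieldSpace {V : Type*} [AddCommGroup V] [Module ℂ V] {A : WeakQVA V}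
    {W : Type*} [AddCommGroup W] [Module ℂ W] (M : PhiQuasiModule A W) :
    Submodule ℂ (Fields W) := LinearMap.range M.YW

/-- Quasi `𝒮_trig`-local subsets of `𝓔(W)`: for any `a`, `b` in `S` there are `a_i`, `b_i` in `S`,
rational functions `f_i` and a polynomial `p ≠ 0` with `p(x₁ / x₂) a(x₁) b(x₂) =`
`p(x₁ / x₂) ∑ i, ι_{x₂,x₁}(f_i(x₂ / x₁)) b_i(x₂) a_i(x₁)`. -/
def IsQuasiSTrigLocal {W : Type*} [AddCommGroup W] [Module ℂ W] (S : Set (Fields W)) : Prop :=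
  ∀ a ∈ S, ∀ b ∈ S, ∃ (r : ℕ) (a' b' : Fin r → Fields W) (f : Fin r → RatFunc ℂ)
    (p : Polynomial ℂ), (∀ i, a' i ∈ S) ∧ (∀ i, b' i ∈ S) ∧ p ≠ 0 ∧ ∀ w,
      mulPoly p (prodSeries a b w) =
        mulPoly p (∑ i, mulSeries (iotaRatio (f i)) (swap (prodSeries (b' i) (a' i) w)))

end QVA

end

/-!
# Fields of a quasi module over a weak quantum vertex algebra of T-type

For `u, v ∈ V`, associativity of the module says that `Y_𝓔^e(Y_W(u, x), z) Y_W(v, x)` equals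
`Y_W(Y(u, z) v, x)` (`PhiQuasiModule.map_YW`). Hence the image of `Y(u, z) v` in `V_W` depends only
on the images of `u` and `v`, and the whole structure of `V`, the `𝒮`-Jacobi identity included, is
transported along the surjection `V → V_W` (`WeakQVA.exists_of_surjective`). The Jacobi identity is
a family of relations between finite sums, so it survives a linear map; the finiteness holds
because all products of fields occurring in it are in `W((x₁))((x₂))` (`IteratedLaurent`).

The condition of T-type is needed for quasi `𝒮_trig`-locality only. Applying the relation of T-type
to the vacuum, and rewriting `Y(a, x₁) Y(b, x₂) 1` as `Y(Y(a, x₁ - x₂) b, x₂) 1`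
(`coeff_Y_Y_vac`), one finds at `x₂ = 0` the skew symmetry
`Y(u, z) v = ∑ i, f_i(e ^ z) Y(Y(v_i, -z) u_i, z) 1` (`skew_symmetry`). In the module,
`Y_W(Y(c, z) 1, x) = Y_W(c, x e ^ z)` (`PhiQuasiModule.fieldCoeff_YW_coeff_vac`). Now choose a
polynomial `p` that clears the denominators of the `f_i` and makes
`p(x₁ / x₂) Y_W(u, x₁) Y_W(v, x₂)` and all `p(x₁ / x₂) f_i(x₁ / x₂) Y_W(v_i, x₂) Y_W(u_i, x₁)`
elements of `Hom(W, W((x₁, x₂)))`. At `x₁ = x₂ e ^ z` the first becomes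
`p(e ^ z) Y_W(Y(u, z) v, x₂)`, and the sum of the others becomes
`p(e ^ z) ∑ i, f_i(e ^ z) Y_W(Y(v_i, -z) u_i, x₂ e ^ z)` (`map_expSubst_swap`). These agree by skew
symmetry, and the substitution is injective on `Hom(W, W((x₁, x₂)))` (`eq_of_map_expSubst`), so the
first equals the sum of the others; this is quasi locality.
-/

noncomputable section

namespace QVA

/-! ### Laurent series -/

section LaurentBasics

variable {U V W : Type*} [AddCommGroup U] [Module ℂ U] [AddCommGroup V] [Module ℂ V]
  [AddCommGroup W] [Module ℂ W]

@[simp] theorem Laurent.coeff_zero (n : ℤ) : Laurent.coeff (0 : Laurent W) n = 0 := rfl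

@[simp] theorem Laurent.coeff_add (A B : Laurent W) (n : ℤ) :
    Laurent.coeff (A + B) n = A.coeff n + B.coeff n := rfl

@[simp] theorem Laurent.coeff_map (g : U →ₗ[ℂ] V) (A : Laurent U) (n : ℤ) :
    (Laurent.map g A).coeff n = g (A.coeff n) := rfl

@[simp] theorem Laurent.coeff_sum {ι : Type*} (s : Finset ι) (F : ι → Laurent W) (n : ℤ) :
    Laurent.coeff (∑ i ∈ s, F i) n = ∑ i ∈ s, (F i).coeff n := by
  induction s using Finset.cons_induction with
  | empty => rfl
  | cons a s ha ih => rw [Finset.sum_cons, Finset.sum_cons, ← ih, Laurent.coeff_add]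

theorem Laurent.exists_lower_bound (A : Laurent W) : ∃ N : ℤ, ∀ n < N, A.coeff n = 0 := by
  by_cases h : (HahnModule.of ℂ).symm A = 0
  · exact ⟨0, fun n _ => by simp [Laurent.coeff, h]⟩
  · exact ⟨((HahnModule.of ℂ).symm A).order, fun n hn => HahnSeries.coeff_eq_zero_of_lt_order hn⟩

theorem laurentSeries_exists_lower_bound (f : LaurentSeries ℂ) :
    ∃ N : ℤ, ∀ n < N, f.coeff n = 0 :=
  ⟨f.order, fun _ hn => HahnSeries.coeff_eq_zero_of_lt_order hn⟩

theorem Laurent.finite_support_smul (f : LaurentSeries ℂ) (A : Laurent W) (n : ℤ) :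
    (Function.support fun s : ℤ => f.coeff s • A.coeff (n - s)).Finite := by
  obtain ⟨N, hN⟩ := laurentSeries_exists_lower_bound f
  obtain ⟨M, hM⟩ := A.exists_lower_bound
  refine (Set.finite_Icc N (n - M)).subset fun s hs => ?_
  by_contra h
  rw [Set.mem_Icc, not_and_or, not_le, not_le] at h
  refine hs ?_
  rcases h with h | h
  · simp [hN s h]
  · simp [hM (n - s) (by omega)]

theorem Laurent.coeff_smul (f : LaurentSeries ℂ) (A : Laurent W) (n : ℤ) :
    Laurent.coeff (f • A) n = ∑ᶠ s : ℤ, f.coeff s • A.coeff (n - s) := by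
  classical
  change ((HahnModule.of ℂ).symm _).coeff n = _
  rw [HahnModule.coeff_smul]
  set S := Finset.VAddAntidiagonal (n : ℤ) (Set.VAddAntidiagonal.finite_of_isPWO f.isPWO_support
    ((HahnModule.of ℂ).symm A).isPWO_support n) with hS
  have key : ∀ ij ∈ S, ij.2 = n - ij.1 := by
    intro ij hij
    have h := ((Finset.mem_vaddAntidiagonal _ _).1 hij).2.2
    rw [vadd_eq_add] at h
    omega
  have hsub : (Function.support fun s : ℤ => f.coeff s • A.coeff (n - s)) ⊆
      ((S.image Prod.fst : Finset ℤ) : Set ℤ) := by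
    intro s hs
    rw [Finset.mem_coe, Finset.mem_image]
    refine ⟨(s, n - s), (Finset.mem_vaddAntidiagonal _ _).2 ⟨?_, ?_, ?_⟩, rfl⟩
    · exact fun h => hs (by simp [h])
    · exact fun h => hs (by
        have : A.coeff (n - s) = 0 := h
        simp [this])
    · rw [vadd_eq_add]; ring
  rw [finsum_eq_sum_of_support_subset _ hsub, Finset.sum_image]
  · exact Finset.sum_congr rfl fun ij hij => by rw [← key ij hij]; rfl
  · intro a ha b hb hab
    exact Prod.ext hab (by rw [key a ha, key b hb, hab])

theorem Laurent.map_smul (g : U →ₗ[ℂ] V) (f : LaurentSeries ℂ) (A : Laurent U) :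
    Laurent.map g (f • A) = f • Laurent.map g A := by
  refine Laurent.ext fun n => ?_
  rw [Laurent.coeff_map, Laurent.coeff_smul, Laurent.coeff_smul,
    show g (∑ᶠ s : ℤ, f.coeff s • A.coeff (n - s)) = ∑ᶠ s : ℤ, g (f.coeff s • A.coeff (n - s)) from
      AddMonoidHom.map_finsum g.toAddMonoidHom (Laurent.finite_support_smul f A n)]
  simp

theorem Laurent.map_map (g : U →ₗ[ℂ] V) (h : V →ₗ[ℂ] W) (A : Laurent U) :
    Laurent.map h (Laurent.map g A) = Laurent.map (h ∘ₗ g) A := rfl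

theorem Laurent.map_injective {g : U →ₗ[ℂ] V} (hg : Function.Injective g) :
    Function.Injective (Laurent.map g) := fun _ _ h =>
  Laurent.ext fun n => hg (congrArg (fun C => Laurent.coeff C n) h)

theorem Laurent.coeff_single_one_smul (k : ℤ) (A : Laurent W) (n : ℤ) :
    Laurent.coeff ((HahnSeries.single k (1 : ℂ) : LaurentSeries ℂ) • A) n = A.coeff (n - k) := by
  rw [Laurent.coeff_smul, finsum_eq_single _ k]
  · simp
  · intro s hs
    rw [HahnSeries.coeff_single_of_ne hs, zero_smul]

/-! ### The substitution `z ↦ -z` -/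

theorem coeff_mul_eq_finsum (f g : LaurentSeries ℂ) (n : ℤ) :
    (f * g).coeff n = ∑ᶠ s : ℤ, f.coeff s * g.coeff (n - s) :=
  Laurent.coeff_smul f (HahnModule.of ℂ g : Laurent ℂ) n

theorem neg_one_zpow_eq_mul (n s : ℤ) : ((-1 : ℂ)) ^ n = (-1) ^ s * (-1) ^ (n - s) := by
  rw [← zpow_add₀ (by norm_num)]
  congr 1
  ring

/-- The automorphism `f(z) ↦ f(-z)` of the field `ℂ((z))`. -/
def negVar : LaurentSeries ℂ →+* LaurentSeries ℂ where
  toFun f := ⟨fun n => (-1) ^ n * f.coeff n,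
    f.isPWO_support.mono fun n hn h => hn (by simp [h])⟩
  map_one' := by
    ext n
    by_cases h : n = 0 <;> simp [HahnSeries.coeff_one, h]
  map_zero' := by ext n; simp
  map_add' f g := by ext n; simp [mul_add]
  map_mul' f g := by
    ext n
    rw [coeff_mul_eq_finsum]
    change (-1) ^ n * (f * g).coeff n = _
    rw [coeff_mul_eq_finsum, ← smul_eq_mul, smul_finsum]
    refine finsum_congr fun s => ?_
    rw [smul_eq_mul, neg_one_zpow_eq_mul n s]
    ring

@[simp] theorem negVar_coeff (f : LaurentSeries ℂ) (n : ℤ) :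
    (negVar f).coeff n = (-1) ^ n * f.coeff n := rfl

theorem negVar_negVar (f : LaurentSeries ℂ) : negVar (negVar f) = f := by
  ext n
  rw [negVar_coeff, negVar_coeff, ← mul_assoc, ← mul_zpow]
  norm_num

/-- The substitution `A(z) ↦ A(-z)` on `W((z))`; it is semilinear with respect to `negVar`. -/
def Laurent.neg (A : Laurent W) : Laurent W :=
  HahnModule.of ℂ ⟨fun n => (-1 : ℂ) ^ n • A.coeff n,
    ((HahnModule.of ℂ).symm A).isPWO_support.mono fun n hn h => hn (by
      have : A.coeff n = 0 := h
      simp [this])⟩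

@[simp] theorem Laurent.coeff_neg (A : Laurent W) (n : ℤ) :
    A.neg.coeff n = (-1 : ℂ) ^ n • A.coeff n := rfl

theorem Laurent.neg_smul (f : LaurentSeries ℂ) (A : Laurent W) :
    Laurent.neg (f • A) = negVar f • A.neg := by
  refine Laurent.ext fun n => ?_
  rw [Laurent.coeff_neg, Laurent.coeff_smul, Laurent.coeff_smul,
    smul_finsum]
  refine finsum_congr fun s => ?_
  rw [negVar_coeff, Laurent.coeff_neg, smul_smul, smul_smul, neg_one_zpow_eq_mul n s]
  congr 1
  ring

theorem negVar_C (c : ℂ) : negVar (HahnSeries.C c) = HahnSeries.C c := by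
  ext n
  by_cases h : n = 0 <;> simp [HahnSeries.C_apply, h]

theorem ofPowerSeries_coeff_neg (f : PowerSeries ℂ) {n : ℤ} (hn : n < 0) :
    (HahnSeries.ofPowerSeries ℤ ℂ f).coeff n = 0 := by
  rw [HahnSeries.ofPowerSeries_apply, HahnSeries.embDomain_of_notMem_range]
  rintro ⟨m, hm⟩
  have : (m : ℤ) = n := hm
  omega

/-! ### Exponentials -/

theorem negVar_expL : negVar expL = expNegL := by
  ext n
  rcases lt_or_ge n 0 with hn | hn
  · simp [expL, expNegL, ofPowerSeries_coeff_neg _ hn]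
  · lift n to ℕ using hn
    simp [expL, expNegL, PowerSeries.coeff_rescale]

theorem expL_mul_expNegL : expL * expNegL = 1 := by
  rw [expL, expNegL, ← map_mul]
  have := PowerSeries.exp_mul_exp_neg_eq_one (A := ℂ)
  rw [PowerSeries.evalNegHom] at this
  rw [this, map_one]

theorem negVar_polyExp (p : Polynomial ℂ) :
    negVar (polyExp p) = p.eval₂ HahnSeries.C expNegL := by
  rw [polyExp, Polynomial.hom_eval₂, negVar_expL]
  congr 1
  exact RingHom.ext negVar_C

theorem negVar_ratSubst (f : RatFunc ℂ) : negVar (ratSubst f expL) = ratSubst f expNegL := by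
  rw [ratSubst, ratSubst, RatFunc.eval, RatFunc.eval, map_div₀]
  exact congrArg₂ _ (negVar_polyExp _) (negVar_polyExp _)

/-- `e ^ (dz) q(e ^ (-z)) = q^*(e ^ z)` for the reflected polynomial `q^*(x) = x ^ d q(x⁻¹)`. -/
theorem polyExp_reflect (q : Polynomial ℂ) {d : ℕ} (hd : q.natDegree ≤ d) :
    polyExp (q.reflect d) = expL ^ d * negVar (polyExp q) := by
  rw [negVar_polyExp, polyExp]
  let _ : Invertible expNegL := ⟨expL, expL_mul_expNegL, by rw [mul_comm, expL_mul_expNegL]⟩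
  have h := Polynomial.eval₂_reflect_mul_pow (HahnSeries.C : ℂ →+* LaurentSeries ℂ) expNegL d q hd
  rw [← h]
  change _ = expL ^ d * (Polynomial.eval₂ HahnSeries.C expL _ * expNegL ^ d)
  rw [mul_comm, mul_assoc, ← mul_pow, mul_comm expNegL, expL_mul_expNegL, one_pow, mul_one]

/-- `e ^ (νz) ∈ ℂ[[z]]`. -/
def expScaled (ν : ℂ) : PowerSeries ℂ := PowerSeries.rescale ν (PowerSeries.exp ℂ)

theorem coeff_expScaled (ν : ℂ) (n : ℕ) :
    PowerSeries.coeff n (expScaled ν) = ν ^ n / (n.factorial : ℂ) := by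
  simp [expScaled, PowerSeries.coeff_rescale, PowerSeries.coeff_exp, div_eq_mul_inv]

end LaurentBasics

/-! ### Iterated Laurent series -/

section Iterated

variable {V W : Type*} [AddCommGroup V] [Module ℂ V] [AddCommGroup W] [Module ℂ W]

/-- The space `W((x₁))((x₂))`, which contains `a(x₁) b(x₂) w`. The bound on the powers of `x₁` is
required to be uniform in the coefficients of `x₂ ^ n'`, `n' ≤ n`. -/
def IteratedLaurent (W : Type*) [AddCommGroup W] [Module ℂ W] : Submodule ℂ (ℤ → ℤ → W) where
  carrier := {A | (∃ N : ℤ, ∀ m n, n < N → A m n = 0) ∧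
    ∀ n : ℤ, ∃ M : ℤ, ∀ n' ≤ n, ∀ m < M, A m n' = 0}
  zero_mem' := ⟨⟨0, fun _ _ _ => rfl⟩, fun _ => ⟨0, fun _ _ _ _ => rfl⟩⟩
  add_mem' := by
    rintro A B ⟨⟨N, hN⟩, hA⟩ ⟨⟨N', hN'⟩, hB⟩
    refine ⟨⟨min N N', fun m n h => ?_⟩, fun n => ?_⟩
    · rw [Pi.add_apply, Pi.add_apply, hN m n (by omega), hN' m n (by omega), add_zero]
    · obtain ⟨M, hM⟩ := hA n
      obtain ⟨M', hM'⟩ := hB n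
      refine ⟨min M M', fun n' hn' m hm => ?_⟩
      rw [Pi.add_apply, Pi.add_apply, hM n' hn' m (by omega), hM' n' hn' m (by omega), add_zero]
  smul_mem' := by
    rintro c A ⟨⟨N, hN⟩, hA⟩
    refine ⟨⟨N, fun m n h => ?_⟩, fun n => ?_⟩
    · rw [Pi.smul_apply, Pi.smul_apply, hN m n h, smul_zero]
    · obtain ⟨M, hM⟩ := hA n
      exact ⟨M, fun n' hn' m hm => by rw [Pi.smul_apply, Pi.smul_apply, hM n' hn' m hm, smul_zero]⟩

theorem coeff_field_eq_zero (a : Fields W) (w : W) :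
    ∃ N : ℤ, ∀ n < N, HVertexOperator.coeff a n w = 0 :=
  Laurent.exists_lower_bound (a w)

theorem prodSeries_mem (a b : Fields W) (w : W) : prodSeries a b w ∈ IteratedLaurent W := by
  obtain ⟨N, hN⟩ := coeff_field_eq_zero b w
  refine ⟨⟨N, fun m n h => ?_⟩, fun n => ?_⟩
  · change HVertexOperator.coeff a m (HVertexOperator.coeff b n w) = 0
    rw [hN n h, map_zero]
  · choose L hL using fun n' : ℤ => coeff_field_eq_zero a (HVertexOperator.coeff b n' w)
    obtain ⟨M, hM⟩ := ((Finset.Icc N n).image L).bddBelow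
    refine ⟨M, fun n' hn' m hm => ?_⟩
    change HVertexOperator.coeff a m (HVertexOperator.coeff b n' w) = 0
    rcases lt_or_ge n' N with h | h
    · rw [hN n' h, map_zero]
    · have h1 := Finset.mem_coe.2 (Finset.mem_image_of_mem L (Finset.mem_Icc.2 ⟨h, hn'⟩))
      exact hL n' m (hm.trans_le (hM h1))

theorem mulX₁_mem {A : ℤ → ℤ → W} (hA : A ∈ IteratedLaurent W) : mulX₁ A ∈ IteratedLaurent W := by
  obtain ⟨⟨N, hN⟩, h⟩ := hA
  refine ⟨⟨N, fun m n hn => hN _ _ hn⟩, fun n => ?_⟩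
  obtain ⟨M, hM⟩ := h n
  exact ⟨M, fun n' hn' m hm => hM n' hn' _ (by omega)⟩

theorem mulX₂_mem {A : ℤ → ℤ → W} (hA : A ∈ IteratedLaurent W) : mulX₂ A ∈ IteratedLaurent W := by
  obtain ⟨⟨N, hN⟩, h⟩ := hA
  refine ⟨⟨N, fun m n hn => hN _ _ (by omega)⟩, fun n => ?_⟩
  obtain ⟨M, hM⟩ := h n
  exact ⟨M, fun n' hn' m hm => hM _ (by omega) _ hm⟩

theorem mulDiffPow_succ (k : ℕ) (A : ℤ → ℤ → W) :
    mulDiffPow (k + 1) A = mulX₁ (mulDiffPow k A) - mulX₂ (mulDiffPow k A) := by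
  rw [mulDiffPow, pow_succ']
  rfl

theorem mulDiffPow_mem (k : ℕ) {A : ℤ → ℤ → W} (hA : A ∈ IteratedLaurent W) :
    mulDiffPow k A ∈ IteratedLaurent W := by
  induction k with
  | zero => exact hA
  | succ k ih =>
    rw [mulDiffPow_succ]
    exact (IteratedLaurent W).sub_mem (mulX₁_mem ih) (mulX₂_mem ih)

theorem iotaDiff_of_neg (h : LaurentSeries ℂ) (s : ℤ) {t : ℤ} (ht : t < 0) :
    iotaDiff h s t = 0 := if_neg (by omega)

theorem iotaDiff_natCast (h : LaurentSeries ℂ) (s : ℤ) (t : ℕ) :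
    iotaDiff h s t = h.coeff (s + t) * ((Ring.choose (s + t) t : ℤ) : ℂ) * (-1) ^ t := by
  rw [iotaDiff, if_pos (by omega), Int.toNat_natCast]

theorem iotaDiff_eq_zero (h : LaurentSeries ℂ) {s t : ℤ} (hst : h.coeff (s + t) = 0) :
    iotaDiff h s t = 0 := by
  rw [iotaDiff, hst, zero_mul, zero_mul, ite_self]

theorem finite_support_iotaDiff (h : LaurentSeries ℂ) {A : ℤ → ℤ → W} (hA : A ∈ IteratedLaurent W)
    (m n : ℤ) : (Function.support fun s : ℤ × ℤ =>
      iotaDiff h s.1 s.2 • A (m - s.1) (n - s.2)).Finite := by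
  obtain ⟨⟨N, hN⟩, hA⟩ := hA
  obtain ⟨M, hM⟩ := hA n
  obtain ⟨K, hK⟩ := laurentSeries_exists_lower_bound h
  refine ((Set.finite_Icc (K - (n - N)) (m - M)).prod (Set.finite_Icc 0 (n - N))).subset ?_
  rintro ⟨s, t⟩ hst
  have ht : 0 ≤ t := by
    by_contra ht
    exact hst (by simp [iotaDiff_of_neg h s (not_le.1 ht)])
  have h1 : K ≤ s + t := by
    by_contra h1
    exact hst (by simp [iotaDiff_eq_zero h (hK (s + t) (by omega))])
  have h2 : N ≤ n - t := by
    by_contra h2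
    exact hst (by simp [hN (m - s) (n - t) (by omega)])
  have h3 : M ≤ m - s := by
    by_contra h3
    exact hst (by simp [hM (n - t) (by omega) (m - s) (by omega)])
  simp only [Set.mem_prod, Set.mem_Icc]
  omega

theorem mulSeries_iotaDiff_eq_zero (h : LaurentSeries ℂ) {A : ℤ → ℤ → W} {N : ℤ}
    (hN : ∀ m n, n < N → A m n = 0) (m : ℤ) {n : ℤ} (hn : n < N) :
    mulSeries (iotaDiff h) A m n = 0 := by
  refine finsum_eq_zero_of_forall_eq_zero fun s => ?_
  rcases lt_or_ge s.2 0 with h0 | h0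
  · rw [iotaDiff_of_neg h s.1 h0, zero_smul]
  · rw [hN _ _ (by omega), smul_zero]

theorem mulSeries_iotaDiff_mem (h : LaurentSeries ℂ) {A : ℤ → ℤ → W}
    (hA : A ∈ IteratedLaurent W) : mulSeries (iotaDiff h) A ∈ IteratedLaurent W := by
  obtain ⟨⟨N, hN⟩, hA⟩ := hA
  refine ⟨⟨N, fun m n hn => mulSeries_iotaDiff_eq_zero h hN m hn⟩, fun n => ?_⟩
  obtain ⟨M, hM⟩ := hA n
  obtain ⟨K, hK⟩ := laurentSeries_exists_lower_bound h
  refine ⟨M + (K - (n - N)), fun n' hn' m hm => finsum_eq_zero_of_forall_eq_zero ?_⟩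
  rintro ⟨s, t⟩
  change iotaDiff h s t • A (m - s) (n' - t) = 0
  rcases lt_or_ge t 0 with h0 | h0
  · rw [iotaDiff_of_neg h s h0, zero_smul]
  rcases lt_or_ge (s + t) K with h1 | h1
  · rw [iotaDiff_eq_zero h (hK _ h1), zero_smul]
  rcases lt_or_ge (n' - t) N with h2 | h2
  · rw [hN _ _ h2, smul_zero]
  · rw [hM (n' - t) (by omega) (m - s) (by omega), smul_zero]

theorem map_mulSeries (g : V →ₗ[ℂ] W) (c : ℤ → ℤ → ℂ) (A : ℤ → ℤ → V) (m n : ℤ)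
    (hfin : (Function.support fun s : ℤ × ℤ => c s.1 s.2 • A (m - s.1) (n - s.2)).Finite) :
    g (mulSeries c A m n) = mulSeries c (fun m n => g (A m n)) m n := by
  refine (AddMonoidHom.map_finsum g.toAddMonoidHom hfin).trans (finsum_congr fun s => ?_)
  exact map_smul g _ _

/-! ### Multiplication by powers of `x₁ - x₂` -/

theorem mulX₁_mulSeries (c : ℤ → ℤ → ℂ) (A : ℤ → ℤ → W) :
    mulX₁ (mulSeries c A) = mulSeries c (mulX₁ A) := by
  funext m n
  refine finsum_congr fun s => ?_
  change c s.1 s.2 • A (m - 1 - s.1) (n - s.2) = c s.1 s.2 • A (m - s.1 - 1) (n - s.2)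
  rw [sub_right_comm]

theorem mulX₂_mulSeries (c : ℤ → ℤ → ℂ) (A : ℤ → ℤ → W) :
    mulX₂ (mulSeries c A) = mulSeries c (mulX₂ A) := by
  funext m n
  refine finsum_congr fun s => ?_
  change c s.1 s.2 • A (m - s.1) (n - 1 - s.2) = c s.1 s.2 • A (m - s.1) (n - s.2 - 1)
  rw [sub_right_comm n]

theorem mulDiff_mulSeries (h : LaurentSeries ℂ) {A : ℤ → ℤ → W} (hA : A ∈ IteratedLaurent W) :
    mulX₁ (mulSeries (iotaDiff h) A) - mulX₂ (mulSeries (iotaDiff h) A) =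
      mulSeries (iotaDiff h) (mulX₁ A - mulX₂ A) := by
  rw [mulX₁_mulSeries, mulX₂_mulSeries]
  funext m n
  refine (finsum_sub_distrib (finite_support_iotaDiff h (mulX₁_mem hA) m n)
    (finite_support_iotaDiff h (mulX₂_mem hA) m n)).symm.trans (finsum_congr fun s => ?_)
  exact (smul_sub _ _ _).symm

/-- Pascal's rule: `(x₁ - x₂) h(x₁ - x₂)` is the expansion of `x h(x)` at `x = x₁ - x₂`. -/
theorem iotaDiff_single_mul (h : LaurentSeries ℂ) (s t : ℤ) :
    iotaDiff (HahnSeries.single 1 1 * h) s t = iotaDiff h (s - 1) t - iotaDiff h s (t - 1) := by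
  have hc : ∀ n : ℤ, (HahnSeries.single 1 1 * h : LaurentSeries ℂ).coeff n = h.coeff (n - 1) := by
    intro n
    have := HahnSeries.coeff_single_mul (r := (1 : ℂ)) (x := h) (a := n) (b := (1 : ℤ))
    rw [this, one_mul]
  rcases lt_or_ge t 0 with ht | ht
  · rw [iotaDiff_of_neg _ _ ht, iotaDiff_of_neg _ _ ht, iotaDiff_of_neg _ _ (by omega), sub_zero]
  lift t to ℕ using ht
  rcases t with _ | t
  · rw [iotaDiff_of_neg _ _ (show ((0 : ℕ) : ℤ) - 1 < 0 by norm_num), iotaDiff_natCast,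
      iotaDiff_natCast, hc]
    simp
  · rw [show ((t + 1 : ℕ) : ℤ) - 1 = t by push_cast; ring, iotaDiff_natCast, iotaDiff_natCast,
      iotaDiff_natCast, hc]
    have e1 : s + ((t + 1 : ℕ) : ℤ) = s + t + 1 := by push_cast; ring
    have e2 : s - 1 + ((t + 1 : ℕ) : ℤ) = s + t := by push_cast; ring
    rw [e1, e2, Ring.choose_succ_succ, add_sub_cancel_right]
    push_cast
    ring

theorem mulSeries_iotaDiff_single_mul (h : LaurentSeries ℂ) {A : ℤ → ℤ → W}
    (hA : A ∈ IteratedLaurent W) :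
    mulSeries (iotaDiff (HahnSeries.single 1 1 * h)) A =
      mulX₁ (mulSeries (iotaDiff h) A) - mulX₂ (mulSeries (iotaDiff h) A) := by
  funext m n
  have h1 := finsum_comp_equiv ((Equiv.subRight (1 : ℤ)).prodCongr (Equiv.refl ℤ))
    (f := fun s : ℤ × ℤ => iotaDiff h s.1 s.2 • A (m - 1 - s.1) (n - s.2))
  have h2 := finsum_comp_equiv ((Equiv.refl ℤ).prodCongr (Equiv.subRight (1 : ℤ)))
    (f := fun s : ℤ × ℤ => iotaDiff h s.1 s.2 • A (m - s.1) (n - 1 - s.2))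
  change _ = mulSeries (iotaDiff h) A (m - 1) n - mulSeries (iotaDiff h) A m (n - 1)
  rw [mulSeries, mulSeries, mulSeries, ← h1, ← h2, ← finsum_sub_distrib]
  · refine finsum_congr fun s => ?_
    simp only [Equiv.prodCongr_apply, Prod.map_fst, Prod.map_snd, Equiv.subRight_apply,
      Equiv.refl_apply]
    rw [iotaDiff_single_mul, sub_smul, sub_sub_sub_cancel_right, sub_sub_sub_cancel_right]
  · exact (finite_support_iotaDiff h hA (m - 1) n).preimage (Equiv.injective _).injOn
  · exact (finite_support_iotaDiff h hA m (n - 1)).preimage (Equiv.injective _).injOn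

/-- In `(x₁ - x₂) ^ (k + l) h(x₁ - x₂) A`, `k` of the factors may be given to `h` and `l` to `A`. -/
theorem mulDiffPow_mulSeries (k l : ℕ) (h : LaurentSeries ℂ) {A : ℤ → ℤ → W}
    (hA : A ∈ IteratedLaurent W) :
    mulDiffPow (k + l) (mulSeries (iotaDiff h) A) =
      mulSeries (iotaDiff (HahnSeries.single (k : ℤ) 1 * h)) (mulDiffPow l A) := by
  induction k with
  | zero =>
    rw [Nat.cast_zero, zero_add, HahnSeries.single_zero_one, one_mul]
    induction l with
    | zero => rfl
    | succ l ih =>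
      rw [mulDiffPow_succ, mulDiffPow_succ, ih, mulDiff_mulSeries h (mulDiffPow_mem l hA)]
  | succ k ih =>
    have e : (HahnSeries.single ((k + 1 : ℕ) : ℤ) 1 : LaurentSeries ℂ) =
        HahnSeries.single 1 1 * HahnSeries.single (k : ℤ) 1 := by
      rw [HahnSeries.single_mul_single, mul_one]
      congr 2
      push_cast
      ring
    rw [e, mul_assoc, mulSeries_iotaDiff_single_mul _ (mulDiffPow_mem l hA), ← ih,
      Nat.add_right_comm, mulDiffPow_succ]

theorem mulDiffPow_swap (k : ℕ) (A : ℤ → ℤ → W) :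
    mulDiffPow k (swap A) = (-1 : ℂ) ^ k • swap (mulDiffPow k A) := by
  induction k with
  | zero => simp [mulDiffPow]
  | succ k ih =>
    rw [mulDiffPow_succ, mulDiffPow_succ, ih, map_smul, map_smul, ← smul_sub, pow_succ, mul_smul]
    congr 1
    funext m n
    change mulDiffPow k A n (m - 1) - mulDiffPow k A (n - 1) m =
      (-1 : ℂ) • (mulDiffPow k A (n - 1) m - mulDiffPow k A n (m - 1))
    rw [neg_one_smul, neg_sub]

theorem mulDiffPow_eq_zero (k : ℕ) {A : ℤ → ℤ → W} (hA : ∀ m n, n < 0 → A m n = 0) (m : ℤ) {n : ℤ}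
    (hn : n < 0) : mulDiffPow k A m n = 0 := by
  induction k generalizing m n with
  | zero => exact hA m n hn
  | succ k ih =>
    rw [mulDiffPow_succ]
    change mulDiffPow k A (m - 1) n - mulDiffPow k A m (n - 1) = 0
    rw [ih _ hn, ih _ (by omega), sub_zero]

theorem mulDiffPow_coeff_zero (k : ℕ) {A : ℤ → ℤ → W} (hA : ∀ m n, n < 0 → A m n = 0) (m : ℤ) :
    mulDiffPow k A m 0 = A (m - k) 0 := by
  induction k generalizing m with
  | zero => simp [mulDiffPow]
  | succ k ih =>
    rw [mulDiffPow_succ]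
    change mulDiffPow k A (m - 1) 0 - mulDiffPow k A m (0 - 1) = _
    rw [ih, mulDiffPow_eq_zero k hA m (by omega), sub_zero]
    congr 1
    push_cast
    ring

/-! ### The substitution `x₁ = x₀ + x₂` -/

/-- The coefficient of `x₀ ^ m x₂ ^ q` in `A(x₀ + x₂, x₂)`, expanded in nonnegative powers of `x₂`,
for `A` with nonnegative powers of `x₂` only. -/
def shiftSum (A : ℤ → ℤ → W) (m : ℤ) (q : ℕ) : W :=
  ∑ tl ∈ Finset.HasAntidiagonal.antidiagonal q,
    (Ring.choose (m + tl.1) tl.1 : ℤ) • A (m + tl.1) tl.2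

/-- Under `x₁ = x₀ + x₂`, multiplication by `x₁ - x₂` becomes multiplication by `x₀`. -/
theorem shiftSum_mulDiff {A : ℤ → ℤ → W} (hA : ∀ m n, n < 0 → A m n = 0) (m : ℤ) (q : ℕ) :
    shiftSum (mulX₁ A - mulX₂ A) m q = shiftSum A (m - 1) q := by
  have e : ∀ m n, (mulX₁ A - mulX₂ A) m n = A (m - 1) n - A m (n - 1) := fun _ _ => rfl
  simp only [shiftSum, e, smul_sub, Finset.sum_sub_distrib]
  rcases q with _ | q
  · simp [hA _ (-1) (by omega)]
  · rw [Finset.Nat.sum_antidiagonal_succ, Finset.Nat.sum_antidiagonal_succ',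
      Finset.Nat.sum_antidiagonal_succ]
    have h0 : A (m + ((q + 1 : ℕ) : ℤ)) (0 - 1) = 0 := hA _ _ (by norm_num)
    simp only [Nat.cast_zero, h0, smul_zero, zero_add, add_zero, Ring.choose_zero_right, one_smul]
    rw [add_sub_assoc, ← Finset.sum_sub_distrib]
    congr 1
    refine Finset.sum_congr rfl fun tl _ => ?_
    have e1 : m + ((tl.1 + 1 : ℕ) : ℤ) = m + tl.1 + 1 := by push_cast; ring
    have e2 : m - 1 + ((tl.1 + 1 : ℕ) : ℤ) = m + tl.1 := by push_cast; ring
    have e3 : ((tl.2 + 1 : ℕ) : ℤ) - 1 = tl.2 := by push_cast; ring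
    rw [e1, e2, e3, add_sub_cancel_right, ← sub_smul, Ring.choose_succ_succ, add_sub_cancel_left]

theorem shiftSum_mulDiffPow (k : ℕ) {A : ℤ → ℤ → W} (hA : ∀ m n, n < 0 → A m n = 0) (m : ℤ)
    (q : ℕ) : shiftSum (mulDiffPow k A) m q = shiftSum A (m - k) q := by
  induction k generalizing m with
  | zero => simp [mulDiffPow]
  | succ k ih =>
    rw [mulDiffPow_succ, shiftSum_mulDiff (fun m n hn => mulDiffPow_eq_zero k hA m hn), ih]
    congr 1
    push_cast
    ring

/-- The inverse substitution `x₀ = x₁ - x₂`. -/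
theorem eq_sum_shiftSum {G : Type*} [AddCommGroup G] (A : ℤ → ℤ → G) (m : ℤ) (q : ℕ) :
    A m q = ∑ tl ∈ Finset.HasAntidiagonal.antidiagonal q,
      (Ring.choose (-m - 1) tl.1 : ℤ) • shiftSum A (m + tl.1) tl.2 := by
  -- Collect the coefficient of `A (m + n) l`; by Chu-Vandermonde it is `binom(n - 1, n)`.
  have h1 : (∑ tl ∈ Finset.HasAntidiagonal.antidiagonal q,
      (Ring.choose (-m - 1) tl.1 : ℤ) • shiftSum A (m + tl.1) tl.2) =
      ∑ nl ∈ Finset.HasAntidiagonal.antidiagonal q,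
        (∑ tr ∈ Finset.HasAntidiagonal.antidiagonal nl.1,
          Ring.choose (-m - 1) tr.1 * Ring.choose (m + nl.1) tr.2 : ℤ) • A (m + nl.1) nl.2 := by
    simp only [shiftSum, Finset.smul_sum, Finset.sum_smul, Finset.sum_sigma', smul_smul]
    symm
    refine Finset.sum_nbij' (fun ⟨⟨_i, j⟩, ⟨k, l⟩⟩ ↦ ⟨(k, l + j), (l, j)⟩)
      (fun ⟨⟨i, _j⟩, ⟨k, l⟩⟩ ↦ ⟨(i + k, l), (i, k)⟩) ?_ ?_ ?_ ?_ ?_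
    · rintro ⟨⟨i, j⟩, ⟨k, l⟩⟩ h
      simp at h ⊢
      omega
    · rintro ⟨⟨i, j⟩, ⟨k, l⟩⟩ h
      simp at h ⊢
      omega
    · rintro ⟨⟨i, j⟩, ⟨k, l⟩⟩ h
      simp at h ⊢
      omega
    · rintro ⟨⟨i, j⟩, ⟨k, l⟩⟩ h
      simp at h ⊢
      omega
    · rintro ⟨⟨i, j⟩, ⟨k, l⟩⟩ h
      simp only [Finset.mem_sigma, Finset.HasAntidiagonal.mem_antidiagonal] at h
      obtain ⟨-, rfl⟩ := h
      simp only [Nat.cast_add, add_assoc]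
  have h2 : ∀ n : ℕ, (∑ tr ∈ Finset.HasAntidiagonal.antidiagonal n,
      Ring.choose (-m - 1) tr.1 * Ring.choose (m + n) tr.2 : ℤ) = if n = 0 then 1 else 0 := by
    intro n
    rw [← Ring.add_choose_eq n (Commute.all _ _), show -m - 1 + (m + (n : ℤ)) = n - 1 by ring]
    rcases n with _ | n
    · simp
    · rw [Nat.cast_succ, add_sub_cancel_right, Ring.choose_natCast, Nat.choose_succ_self]
      simp
  rw [h1, Finset.sum_eq_single (0, q)]
  · rw [h2]
    simp
  · rintro ⟨n, l⟩ h h0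
    rw [h2, if_neg, zero_smul]
    rintro rfl
    rw [Finset.HasAntidiagonal.mem_antidiagonal] at h
    exact h0 (Prod.ext rfl (by simpa using h))
  · intro h
    exact absurd (Finset.HasAntidiagonal.mem_antidiagonal.2 (zero_add q)) h

/-- If `A(x₀ + x₂, x₂)` has no negative powers of `x₀`, then `A` has no negative powers of `x₁`. -/
theorem eq_zero_of_shiftSum_eq_zero {G : Type*} [AddCommGroup G] {A : ℤ → ℤ → G}
    (hA : ∀ m n, n < 0 → A m n = 0)
    (h : ∀ m < 0, ∀ q, shiftSum A m q = 0) {m : ℤ} (hm : m < 0) (n : ℤ) : A m n = 0 := by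
  rcases lt_or_ge n 0 with hn | hn
  · exact hA m n hn
  lift n to ℕ using hn
  rw [eq_sum_shiftSum A m n]
  refine Finset.sum_eq_zero fun tl _ => ?_
  rcases lt_or_ge (m + tl.1) 0 with h0 | h0
  · rw [h _ h0, smul_zero]
  · obtain ⟨a, ha⟩ := Int.eq_ofNat_of_zero_le (show 0 ≤ -m - 1 by omega)
    rw [ha, Ring.choose_natCast, Nat.choose_eq_zero_of_lt (by omega), Nat.cast_zero, zero_smul]

/-- `A(0, x₂)` is obtained from `A(x₀ + x₂, x₂)` by `x₀ = -x₂`. -/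
theorem coeff_zero_eq_sum_shiftSum (A : ℤ → ℤ → W) (q : ℕ) :
    A 0 q = ∑ tl ∈ Finset.HasAntidiagonal.antidiagonal q,
      (-1 : ℂ) ^ tl.1 • shiftSum A tl.1 tl.2 := by
  refine (eq_sum_shiftSum A 0 q).trans ?_
  refine Finset.sum_congr rfl fun tl _ => ?_
  rw [neg_zero, zero_sub, zero_add, Ring.choose_neg, ← Int.cast_smul_eq_zsmul ℂ]
  congr 1
  rw [show (1 : ℤ) + tl.1 - 1 = (tl.1 : ℤ) by ring, Ring.choose_natCast, Nat.choose_self]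
  simp [Units.smul_def, Int.negOnePow_def]

end Iterated

/-! ### Associativity on the vacuum and skew symmetry -/

section Skew

variable {V W : Type*} [AddCommGroup V] [Module ℂ V] [AddCommGroup W] [Module ℂ W]

theorem prodSeries_vac_eq_zero (A : WeakQVA V) (u v : V) (m n : ℤ) (hn : n < 0) :
    prodSeries (A.Y u) (A.Y v) A.vac m n = 0 := by
  change HVertexOperator.coeff (A.Y u) m (Laurent.coeff (A.Y v A.vac) n) = 0
  rw [A.creation v n hn, map_zero]

theorem mulSeries_iotaDiff_single (n : ℤ) {P : ℤ → ℤ → V} (hP : ∀ m n, n < 0 → P m n = 0) (p : ℤ)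
    (q : ℕ) : mulSeries (iotaDiff (HahnSeries.single n 1)) P p q =
      ∑ tl ∈ Finset.HasAntidiagonal.antidiagonal q,
        (((Ring.choose n tl.1 : ℤ) : ℂ) * (-1) ^ tl.1) • P (p - n + tl.1) tl.2 := by
  classical
  have hsub : (Function.support fun s : ℤ × ℤ =>
      iotaDiff (HahnSeries.single n 1) s.1 s.2 • P (p - s.1) (q - s.2)) ⊆
      (((Finset.HasAntidiagonal.antidiagonal q).image
        fun tl : ℕ × ℕ => (n - (tl.1 : ℤ), (tl.1 : ℤ)) : Finset (ℤ × ℤ)) : Set (ℤ × ℤ)) := by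
    rintro ⟨s, t⟩ hst
    have ht : 0 ≤ t := by
      by_contra ht
      exact hst (by simp [iotaDiff_of_neg _ s (not_le.1 ht)])
    have h1 : s + t = n := by
      by_contra h1
      exact hst (by simp [iotaDiff_eq_zero _ (HahnSeries.coeff_single_of_ne h1)])
    have h2 : 0 ≤ (q : ℤ) - t := by
      by_contra h2
      exact hst (by simp [hP (p - s) (q - t) (by omega)])
    lift t to ℕ using ht
    rw [Finset.mem_coe, Finset.mem_image]
    refine ⟨(t, q - t), Finset.HasAntidiagonal.mem_antidiagonal.2 (by omega), ?_⟩
    rw [← h1, add_sub_cancel_right]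
  rw [mulSeries, finsum_eq_sum_of_support_subset _ hsub, Finset.sum_image]
  · refine Finset.sum_congr rfl fun tl htl => ?_
    have h := Finset.HasAntidiagonal.mem_antidiagonal.1 htl
    rw [iotaDiff_natCast, sub_add_cancel, HahnSeries.coeff_single_same, one_mul,
      show p - (n - (tl.1 : ℤ)) = p - n + tl.1 by ring, show (q : ℤ) - tl.1 = tl.2 by omega]
  · rintro a ha b hb hab
    have ha := Finset.HasAntidiagonal.mem_antidiagonal.1 ha
    have hb := Finset.HasAntidiagonal.mem_antidiagonal.1 hb
    simp only [Prod.mk.injEq, Nat.cast_inj] at hab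
    exact Prod.ext hab.2 (by omega)

/-- Associativity on the vacuum: `Y(Y(u, x₀) v, x₂) 1 = Y(u, x₀ + x₂) Y(v, x₂) 1`. This is the
residue in `x₁` of the Jacobi identity, whose second term has no negative powers of `x₁`. -/
theorem coeff_Y_Y_vac (A : WeakQVA V) (u v : V) (m : ℤ) (q : ℕ) :
    Laurent.coeff (A.Y (Laurent.coeff (A.Y u v) m) A.vac) q =
      shiftSum (prodSeries (A.Y u) (A.Y v) A.vac) m q := by
  obtain ⟨r, u', v', f, hJ⟩ := A.jacobi u v
  have h := hJ A.vac (-m - 1) (-1) q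
  have hX : ∀ s t : ℤ, t < 0 → (∑ i, mulSeries (iotaDiff (f i))
      (prodSeries (A.Y (v' i)) (A.Y (u' i)) A.vac)) s t = 0 := by
    intro s t ht
    rw [Finset.sum_apply, Finset.sum_apply]
    exact Finset.sum_eq_zero fun i _ =>
      mulSeries_iotaDiff_eq_zero _ (prodSeries_vac_eq_zero A _ _) s ht
  rw [mulSeries_iotaDiff_eq_zero _ hX _ (show (-1 : ℤ) < 0 by norm_num), smul_zero, sub_zero,
    mulSeries_iotaDiff_single _ (prodSeries_vac_eq_zero A u v)] at h
  -- On the right, the residue of `(x₁ - x₀) ^ k` in `x₁` is `1` for `k = -1` and `0` otherwise.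
  rw [finsum_eq_single _ ((-1 : ℤ), (0 : ℤ))] at h
  · rw [shiftSum]
    rw [show ((0 : ℤ)) = ((0 : ℕ) : ℤ) from rfl, iotaDiff_natCast] at h
    simp only [Nat.cast_zero, add_zero, HahnSeries.coeff_single_same, Ring.choose_zero_right,
      Int.cast_one, pow_zero, mul_one, one_smul, sub_zero,
      show -(-m - 1) - 1 = m by ring, show (q : ℤ) + -1 + 1 = q by ring] at h
    refine h.symm.trans (Finset.sum_congr rfl fun tl _ => ?_)
    rw [show (-1 : ℤ) - (-m - 1) + tl.1 = m + tl.1 by ring, ← Int.cast_smul_eq_zsmul ℂ]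
    congr 1
    rw [show -m - 1 = -(m + 1) by ring, Ring.choose_neg,
      show m + 1 + (tl.1 : ℤ) - 1 = m + tl.1 by ring]
    simp only [Units.smul_def, Int.negOnePow_def, zpow_natCast, smul_eq_mul]
    push_cast
    rw [mul_right_comm, ← mul_pow]
    norm_num
  · rintro ⟨k, i⟩ hne
    change iotaDiff (HahnSeries.single k 1) (-1) i • _ = _
    rcases lt_or_ge i 0 with hi | hi
    · rw [iotaDiff_of_neg _ _ hi, zero_smul]
    by_cases hk : -1 + i = k
    · lift i to ℕ using hi
      rcases i with _ | i
      · exact absurd (by rw [← hk]; rfl) hne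
      · rw [iotaDiff_natCast, show (-1 : ℤ) + ((i + 1 : ℕ) : ℤ) = (i : ℤ) by push_cast; ring,
          Ring.choose_natCast, Nat.choose_succ_self]
        simp
    · rw [iotaDiff_eq_zero _ (HahnSeries.coeff_single_of_ne hk), zero_smul]

/-- The coefficient of `x₁ ^ 0 x₂ ^ q` in `h(x₁ - x₂) P(x₁, x₂)` for power series `h` and `P`. -/
theorem mulSeries_iotaDiff_coeff_zero {h : LaurentSeries ℂ} (hh : ∀ n < 0, h.coeff n = 0)
    {P : ℤ → ℤ → V} (hP : ∀ m n, n < 0 → P m n = 0) (hP' : ∀ m n, m < 0 → P m n = 0) (q : ℕ) :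
    mulSeries (iotaDiff h) P 0 q = ∑ tl ∈ Finset.HasAntidiagonal.antidiagonal q,
      (negVar h).coeff tl.1 • P 0 tl.2 := by
  classical
  have hsub : (Function.support fun s : ℤ × ℤ =>
      iotaDiff h s.1 s.2 • P (0 - s.1) (q - s.2)) ⊆
      (((Finset.HasAntidiagonal.antidiagonal q).image
        fun tl : ℕ × ℕ => ((0 : ℤ), (tl.1 : ℤ)) : Finset (ℤ × ℤ)) : Set (ℤ × ℤ)) := by
    rintro ⟨s, t⟩ hst
    have ht : 0 ≤ t := by
      by_contra ht
      exact hst (by simp [iotaDiff_of_neg _ s (not_le.1 ht)])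
    have h1 : 0 ≤ s + t := by
      by_contra h1
      exact hst (by simp [iotaDiff_eq_zero _ (hh (s + t) (by omega))])
    have h2 : 0 ≤ (q : ℤ) - t := by
      by_contra h2
      exact hst (by simp [hP (-s) (q - t) (by omega)])
    have h3 : 0 ≤ -s := by
      by_contra h3
      exact hst (by simp [hP' (-s) (q - t) (by omega)])
    lift t to ℕ using ht
    have h4 : s = 0 := by
      by_contra h4
      obtain ⟨a, ha⟩ := Int.eq_ofNat_of_zero_le h1
      refine hst ?_
      change iotaDiff h s t • _ = _
      rw [iotaDiff_natCast, ha, Ring.choose_natCast, Nat.choose_eq_zero_of_lt (by omega)]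
      simp
    rw [Finset.mem_coe, Finset.mem_image]
    exact ⟨(t, q - t), Finset.HasAntidiagonal.mem_antidiagonal.2 (by omega), by rw [h4]⟩
  rw [mulSeries, finsum_eq_sum_of_support_subset _ hsub, Finset.sum_image]
  · refine Finset.sum_congr rfl fun tl htl => ?_
    have h := Finset.HasAntidiagonal.mem_antidiagonal.1 htl
    rw [iotaDiff_natCast, zero_add, Ring.choose_natCast, Nat.choose_self, sub_zero,
      show (q : ℤ) - tl.1 = tl.2 by omega, negVar_coeff, zpow_natCast, Nat.cast_one, Int.cast_one,
      mul_one, mul_comm]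
  · rintro a ha b hb hab
    have ha := Finset.HasAntidiagonal.mem_antidiagonal.1 ha
    have hb := Finset.HasAntidiagonal.mem_antidiagonal.1 hb
    simp only [Prod.mk.injEq, Nat.cast_inj] at hab
    exact Prod.ext hab.2 (by omega)

theorem exists_ofPowerSeries {f : LaurentSeries ℂ} (hf : ∀ n < 0, f.coeff n = 0) :
    ∃ F : PowerSeries ℂ, f = HahnSeries.ofPowerSeries ℤ ℂ F := by
  refine ⟨PowerSeries.mk fun n => f.coeff n, ?_⟩
  ext n
  rcases lt_or_ge n 0 with hn | hn
  · rw [hf n hn, ofPowerSeries_coeff_neg _ hn]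
  · lift n to ℕ using hn
    rw [HahnSeries.ofPowerSeries_apply_coeff, PowerSeries.coeff_mk]

theorem coeff_single_mul_one (k : ℤ) (f : LaurentSeries ℂ) (n : ℤ) :
    (HahnSeries.single k 1 * f : LaurentSeries ℂ).coeff n = f.coeff (n - k) := by
  have := HahnSeries.coeff_single_mul (r := (1 : ℂ)) (x := f) (a := n) (b := k)
  rw [this, one_mul]

theorem negVar_single_natCast (k : ℕ) :
    negVar (HahnSeries.single (k : ℤ) 1) = (-1 : ℂ) ^ k • HahnSeries.single (k : ℤ) 1 := by
  ext n
  by_cases h : n = k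
  · subst h
    simp
  · simp [HahnSeries.coeff_single_of_ne h]

/-- The coefficient extraction behind skew symmetry: the coefficients of `x₁ ^ 0` in
`(x₁ - x₂) ^ (2k) h(x₁ - x₂) Y(a, x₁) Y(b, x₂) 1`, for `k` large, under a linear map `φ` for which
`φ(Y(c, x) 1) = e ^ (νx) φ(c)`. -/
theorem map_mulDiffPow_coeff_zero (A : WeakQVA V) (a b : V) (h : LaurentSeries ℂ) (k : ℕ)
    (hh : ∀ n : ℤ, n < -k → h.coeff n = 0)
    (hk : ∀ n : ℤ, n < -k → Laurent.coeff (A.Y a b) n = 0)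
    (φ : V →ₗ[ℂ] W) (ν : ℂ) (hφ : ∀ (c : V) (l : ℕ),
      φ (Laurent.coeff (A.Y c A.vac) l) = (ν ^ l / (l.factorial : ℂ)) • φ c) (m : ℤ) :
    φ (mulDiffPow (k + k) (mulSeries (iotaDiff h) (prodSeries (A.Y a) (A.Y b) A.vac)) 0 m) =
      Laurent.coeff (HahnSeries.single ((k + k : ℕ) : ℤ) (1 : ℂ) •
        ((negVar h * HahnSeries.ofPowerSeries ℤ ℂ (expScaled ν)) •
          (Laurent.map φ (A.Y a b)).neg)) m := by
  set P := prodSeries (A.Y a) (A.Y b) A.vac with hPdef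
  have hP : ∀ m n, n < 0 → P m n = 0 := prodSeries_vac_eq_zero A a b
  -- One factor `(x₁ - x₂) ^ k` removes the pole of `h`, the other one that of
  -- `Y(a, x₁) Y(b, x₂) 1`, so that `H` and `Q` are power series.
  rw [mulDiffPow_mulSeries k k h (prodSeries_mem _ _ _)]
  set Q := mulDiffPow k P with hQdef
  set H : LaurentSeries ℂ := HahnSeries.single (k : ℤ) 1 * h with hHdef
  have hH : ∀ n < 0, H.coeff n = 0 := fun n hn => by
    rw [hHdef, coeff_single_mul_one, hh _ (by omega)]
  have hQ : ∀ m n, n < 0 → Q m n = 0 := fun m n hn => mulDiffPow_eq_zero k hP m hn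
  have hQs : ∀ m q, shiftSum Q m q =
      Laurent.coeff (A.Y (Laurent.coeff (A.Y a b) (m - k)) A.vac) q := fun m q => by
    rw [hQdef, shiftSum_mulDiffPow k hP, coeff_Y_Y_vac]
  have hQ' : ∀ m n, m < 0 → Q m n = 0 := fun m n hm =>
    eq_zero_of_shiftSum_eq_zero hQ (fun m hm q => by
      rw [hQs, hk _ (by omega), map_zero, LinearMap.zero_apply, Laurent.coeff_zero]) hm n
  set B : Laurent W := (HahnSeries.single (k : ℤ) (1 : ℂ) • Laurent.map φ (A.Y a b) :
    Laurent W).neg with hBdef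
  have hB : ∀ n, B.coeff n = (-1 : ℂ) ^ n • φ (Laurent.coeff (A.Y a b) (n - k)) := fun n => by
    rw [hBdef, Laurent.coeff_neg, Laurent.coeff_single_one_smul, Laurent.coeff_map]
  have hB0 : ∀ n < 0, B.coeff n = 0 := fun n hn => by
    rw [hB, hk _ (by omega), map_zero, smul_zero]
  obtain ⟨F, hF⟩ := exists_ofPowerSeries (f := negVar H) fun n hn => by
    rw [negVar_coeff, hH n hn, mul_zero]
  have hE := coeff_smul_powerSeries (expScaled ν) B hB0
  have hFE := coeff_smul_powerSeries F (HahnSeries.ofPowerSeries ℤ ℂ (expScaled ν) • B) hE.1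
  have hsign : (-1 : ℂ) ^ k * (-1 : ℂ) ^ k = 1 := by
    rw [← mul_pow]
    norm_num
  have key : (HahnSeries.single ((k + k : ℕ) : ℤ) (1 : ℂ) •
        ((negVar h * HahnSeries.ofPowerSeries ℤ ℂ (expScaled ν)) •
          (Laurent.map φ (A.Y a b)).neg) : Laurent W) =
      HahnSeries.ofPowerSeries ℤ ℂ F • (HahnSeries.ofPowerSeries ℤ ℂ (expScaled ν) • B) := by
    rw [hBdef, Laurent.neg_smul, ← hF, hHdef, map_mul, ← laurent_mul_smul, ← laurent_mul_smul,
      ← laurent_mul_smul, negVar_single_natCast]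
    congr 1
    rw [Nat.cast_add, show (HahnSeries.single ((k : ℤ) + k) (1 : ℂ) : LaurentSeries ℂ) =
      HahnSeries.single (k : ℤ) 1 * HahnSeries.single (k : ℤ) 1 by
        rw [HahnSeries.single_mul_single, mul_one]]
    rw [← HahnSeries.C_mul_eq_smul]
    have : (HahnSeries.C ((-1 : ℂ) ^ k) : LaurentSeries ℂ) * HahnSeries.C ((-1 : ℂ) ^ k) = 1 := by
      rw [← map_mul, hsign, map_one]
    linear_combination (-(HahnSeries.single (k : ℤ) 1 * HahnSeries.single (k : ℤ) 1 * negVar h *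
      HahnSeries.ofPowerSeries ℤ ℂ (expScaled ν)) : LaurentSeries ℂ) * this
  rw [key]
  rcases lt_or_ge m 0 with hm | hm
  · rw [mulSeries_iotaDiff_eq_zero _ hQ _ hm, map_zero, hFE.1 m hm]
  lift m to ℕ using hm
  rw [mulSeries_iotaDiff_coeff_zero hH hQ hQ', map_sum, hFE.2]
  refine Finset.sum_congr rfl fun tl _ => ?_
  rw [map_smul, hF, HahnSeries.ofPowerSeries_apply_coeff]
  congr 1
  rw [coeff_zero_eq_sum_shiftSum Q, map_sum, hE.2, ← Finset.Nat.sum_antidiagonal_swap]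
  refine Finset.sum_congr rfl fun sl _ => ?_
  rw [Prod.fst_swap, Prod.snd_swap, map_smul, hQs, hφ, coeff_expScaled, hB, zpow_natCast,
    smul_comm]

/-- Skew symmetry: `Y(u, z) v = ∑ f_i(e ^ z) Y(Y(v_i, -z) u_i, z) 1`, under a linear map `φ` for
which `φ(Y(c, x) 1) = e ^ (νx) φ(c)`. -/
theorem skew_symmetry (A : WeakQVA V) {u v : V} {r : ℕ} {u' v' : Fin r → V}
    {f : Fin r → RatFunc ℂ} {k : ℕ}
    (hT : mulDiffPow k (prodSeries (A.Y u) (A.Y v) A.vac) = mulDiffPow k (swap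
      (∑ i, mulSeries (iotaExp (f i)) (prodSeries (A.Y (v' i)) (A.Y (u' i)) A.vac))))
    (φ : V →ₗ[ℂ] W) (ν : ℂ) (hφ : ∀ (c : V) (l : ℕ),
      φ (Laurent.coeff (A.Y c A.vac) l) = (ν ^ l / (l.factorial : ℂ)) • φ c) :
    Laurent.map φ (A.Y u v) = ∑ i, (ratSubst (f i) expL *
      HahnSeries.ofPowerSeries ℤ ℂ (expScaled ν)) • (Laurent.map φ (A.Y (v' i) (u' i))).neg := by
  choose N hN using fun i => laurentSeries_exists_lower_bound (ratSubst (f i) expNegL)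
  choose M hM using fun i => Laurent.exists_lower_bound (A.Y (v' i) (u' i))
  -- `K` is at least `k` and bounds all pole orders; the even exponent `K + K` makes
  -- `(x₁ - x₂) ^ (K + K)` symmetric in the two variables.
  set K : ℕ := k + ∑ i, (N i).natAbs + ∑ i, (M i).natAbs with hK
  have hNK : ∀ i, (N i).natAbs ≤ K := fun i =>
    (Finset.single_le_sum (f := fun i => (N i).natAbs) (fun _ _ => Nat.zero_le _)
      (Finset.mem_univ i)).trans (by omega)
  have hMK : ∀ i, (M i).natAbs ≤ K := fun i =>
    (Finset.single_le_sum (f := fun i => (M i).natAbs) (fun _ _ => Nat.zero_le _)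
      (Finset.mem_univ i)).trans (by omega)
  obtain ⟨d, hd⟩ : ∃ d, K + K = d + k := ⟨K + K - k, by omega⟩
  have hT' : mulDiffPow (K + K) (prodSeries (A.Y u) (A.Y v) A.vac) = swap (mulDiffPow (K + K)
      (∑ i, mulSeries (iotaExp (f i)) (prodSeries (A.Y (v' i)) (A.Y (u' i)) A.vac))) := by
    have h2 := mulDiffPow_swap (K + K)
      (∑ i, mulSeries (iotaExp (f i)) (prodSeries (A.Y (v' i)) (A.Y (u' i)) A.vac))
    rw [pow_add, ← mul_pow, show (-1 : ℂ) * -1 = 1 by norm_num, one_pow, one_smul] at h2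
    rw [← h2, hd, mulDiffPow, pow_add]
    exact congrArg (fun X => ((mulX₁ - mulX₂) ^ d : Module.End ℂ (ℤ → ℤ → V)) X) hT
  have hcoeff : ∀ m, (HahnSeries.single ((K + K : ℕ) : ℤ) (1 : ℂ) • Laurent.map φ (A.Y u v) :
      Laurent W).coeff m = Laurent.coeff (HahnSeries.single ((K + K : ℕ) : ℤ) (1 : ℂ) •
        (∑ i, (ratSubst (f i) expL * HahnSeries.ofPowerSeries ℤ ℂ (expScaled ν)) •
          (Laurent.map φ (A.Y (v' i) (u' i))).neg)) m := by
    intro m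
    have h := congrArg φ (congrFun (congrFun hT' m) 0)
    rw [mulDiffPow_coeff_zero _ (prodSeries_vac_eq_zero A u v)] at h
    rw [Laurent.coeff_single_one_smul, Laurent.coeff_map, Finset.smul_sum, Laurent.coeff_sum]
    -- At `x₂ = 0`, the left side is `x₁ ^ (2K) Y(u, x₁) v`.
    have e1 : prodSeries (A.Y u) (A.Y v) A.vac (m - ((K + K : ℕ) : ℤ)) 0 =
        Laurent.coeff (A.Y u v) (m - ((K + K : ℕ) : ℤ)) := by
      change Laurent.coeff (A.Y u (Laurent.coeff (A.Y v A.vac) 0)) _ = _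
      rw [A.creation_lim]
    rw [e1] at h
    rw [h, map_sum]
    change φ ((∑ i, mulDiffPow (K + K) _) 0 m) = _
    rw [Finset.sum_apply, Finset.sum_apply, map_sum]
    refine Finset.sum_congr rfl fun i _ => ?_
    rw [iotaExp, map_mulDiffPow_coeff_zero A (v' i) (u' i) _ K
      (fun n hn => hN i n (by have := hNK i; omega))
      (fun n hn => hM i n (by have := hMK i; omega)) φ ν hφ, ← negVar_ratSubst, negVar_negVar]
  have h3 := congrArg (fun X : Laurent W =>
    (HahnSeries.single (-((K + K : ℕ) : ℤ)) (1 : ℂ) : LaurentSeries ℂ) • X) (Laurent.ext hcoeff)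
  simpa only [← laurent_mul_smul, HahnSeries.single_mul_single, neg_add_cancel, mul_one,
    HahnSeries.single_zero_one, one_smul] using h3

end Skew

/-! ### The substitution `x₁ = x₂ e ^ z` -/

section ExpSubst

variable {V W : Type*} [AddCommGroup V] [Module ℂ V] [AddCommGroup W] [Module ℂ W]

/-- The linear map taking a field `a(x)` to the coefficient of `x ^ n` in `a(x) w`. -/
def fieldCoeff (n : ℤ) (w : W) : Fields W →ₗ[ℂ] W where
  toFun a := HVertexOperator.coeff a n w
  map_add' _ _ := rfl
  map_smul' _ _ := rfl

theorem coeff_map_expSubst (B : W →ₗ[ℂ] DoubleLaurent W) (n : ℤ) (w : W) (j : ℕ) :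
    Laurent.coeff (Laurent.map (fieldCoeff n w) (expSubst B)) j =
      ∑ᶠ m : ℤ, ((m : ℂ) ^ j / (j.factorial : ℂ)) • (B w).1 m (n - m) := by
  rw [Laurent.coeff_map, expSubst_coeff_of_nonneg]
  rfl

theorem coeff_map_expSubst_of_neg (B : W →ₗ[ℂ] DoubleLaurent W) (n : ℤ) (w : W) {j : ℤ}
    (hj : j < 0) : Laurent.coeff (Laurent.map (fieldCoeff n w) (expSubst B)) j = 0 := by
  rw [Laurent.coeff_map, expSubst_coeff_of_neg B hj, map_zero]

theorem expSubst_add (B B' : W →ₗ[ℂ] DoubleLaurent W) :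
    expSubst (B + B') = expSubst B + expSubst B' := by
  refine expSubst_ext (fun n hn => ?_) fun n => ?_
  · rw [Laurent.coeff_add, expSubst_coeff_of_neg B hn, expSubst_coeff_of_neg B' hn, add_zero]
  · rw [Laurent.coeff_add, expSubst_coeff_of_nonneg, expSubst_coeff_of_nonneg, LinearMap.comp_add]

theorem expSubst_zero : expSubst (0 : W →ₗ[ℂ] DoubleLaurent W) = 0 :=
  expSubst_ext (fun _ _ => rfl) fun n => by rw [Laurent.coeff_zero, LinearMap.comp_zero]

theorem expSubst_sum {ι : Type*} (s : Finset ι) (B : ι → W →ₗ[ℂ] DoubleLaurent W) :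
    expSubst (∑ i ∈ s, B i) = ∑ i ∈ s, expSubst (B i) := by
  induction s using Finset.cons_induction with
  | empty => exact expSubst_zero
  | cons a s ha ih => rw [Finset.sum_cons, Finset.sum_cons, expSubst_add, ih]

theorem Laurent.map_sum {U : Type*} [AddCommGroup U] [Module ℂ U] (g : U →ₗ[ℂ] W) {ι : Type*}
    (s : Finset ι) (F : ι → Laurent U) :
    Laurent.map g (∑ i ∈ s, F i) = ∑ i ∈ s, Laurent.map g (F i) :=
  Laurent.ext fun n => by
    rw [Laurent.coeff_map, Laurent.coeff_sum, Laurent.coeff_sum, _root_.map_sum]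
    rfl

theorem expScaled_add (a b : ℂ) : expScaled (a + b) = expScaled a * expScaled b :=
  (PowerSeries.exp_mul_exp_eq_exp_add a b).symm

/-- Exchanging the variables: if `x₁ = x₂ e ^ z`, then `x₂ = x₁ e ^ (-z)`, and the coefficient of
`x₁ ^ n` picks up the factor `e ^ (nz)` when expressed in `x₂`. -/
theorem map_expSubst_swap {B B' : W →ₗ[ℂ] DoubleLaurent W} (h : ∀ w, (B' w).1 = swap (B w).1)
    (n : ℤ) (w : W) : Laurent.map (fieldCoeff n w) (expSubst B') =
      HahnSeries.ofPowerSeries ℤ ℂ (expScaled n) •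
        (Laurent.map (fieldCoeff n w) (expSubst B)).neg := by
  have hc := coeff_smul_powerSeries (expScaled n) (Laurent.map (fieldCoeff n w) (expSubst B)).neg
    fun j hj => by rw [Laurent.coeff_neg, coeff_map_expSubst_of_neg B n w hj, smul_zero]
  refine Laurent.ext fun j => ?_
  rcases lt_or_ge j 0 with hj | hj
  · rw [coeff_map_expSubst_of_neg B' n w hj, hc.1 j hj]
  lift j to ℕ using hj
  rw [hc.2, coeff_map_expSubst, ← finsum_comp_equiv (Equiv.subLeft n)]
  simp only [Laurent.coeff_neg, coeff_map_expSubst, smul_finsum]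
  rw [← finsum_sum_comm]
  · refine finsum_congr fun m => ?_
    rw [h, Equiv.subLeft_apply, sub_sub_cancel]
    change _ • (B w).1 m (n - m) = _
    have e := coeff_expScaled ((n : ℂ) + -(m : ℂ)) j
    rw [expScaled_add, PowerSeries.coeff_mul] at e
    rw [Int.cast_sub, sub_eq_add_neg, ← e, Finset.sum_smul]
    refine Finset.sum_congr rfl fun il _ => ?_
    rw [smul_smul, smul_smul, zpow_natCast, coeff_expScaled (-(m : ℂ)), neg_pow (m : ℂ),
      mul_div_assoc, mul_assoc]
  · intro il _
    simp_rw [smul_smul]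
    exact DoubleLaurent.finite_support (B w).2 _ n

/-- A finitely supported sequence is determined by its moments. -/
theorem eq_zero_of_moments {X : ℤ → W} (hX : (Function.support X).Finite)
    (h : ∀ j : ℕ, ∑ᶠ m : ℤ, (m : ℂ) ^ j • X m = 0) : X = 0 := by
  classical
  have hs : ∀ c : ℤ → ℂ, ∑ᶠ m : ℤ, c m • X m = ∑ m ∈ hX.toFinset, c m • X m := fun c =>
    finsum_eq_sum_of_support_subset _ fun m hm => by
      rw [Finset.mem_coe, Set.Finite.mem_toFinset]
      exact fun h0 => hm (by simp [h0])
  have hq : ∀ q : Polynomial ℂ, ∑ m ∈ hX.toFinset, q.eval (m : ℂ) • X m = 0 := by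
    intro q
    induction q using Polynomial.induction_on' with
    | add q r hq hr =>
      simp only [Polynomial.eval_add, add_smul, Finset.sum_add_distrib, hq, hr, add_zero]
    | monomial n a =>
      simp only [Polynomial.eval_monomial, mul_smul, ← Finset.smul_sum]
      rw [← hs, h, smul_zero]
  funext m
  by_contra hm
  have hmS : m ∈ hX.toFinset := (Set.Finite.mem_toFinset _).2 hm
  -- A polynomial that vanishes at every point of the support except `m`.
  have h1 := hq (∏ i ∈ hX.toFinset.erase m, (Polynomial.X - Polynomial.C (i : ℂ)))
  rw [Finset.sum_eq_single_of_mem m hmS] at h1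
  · refine (smul_ne_zero ?_ hm) h1
    rw [Polynomial.eval_prod, Finset.prod_ne_zero_iff]
    intro i hi
    rw [Polynomial.eval_sub, Polynomial.eval_X, Polynomial.eval_C, sub_ne_zero, Ne, Int.cast_inj]
    exact (Finset.mem_erase.1 hi).1.symm
  · intro i hi him
    rw [Polynomial.eval_prod, Finset.prod_eq_zero (Finset.mem_erase.2 ⟨him, hi⟩), zero_smul]
    rw [Polynomial.eval_sub, Polynomial.eval_X, Polynomial.eval_C, sub_self]

/-- The substitution `x₁ = x₂ e ^ z` is injective on `Hom(W, W((x₁, x₂)))`. -/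
theorem eq_of_map_expSubst {B B' : W →ₗ[ℂ] DoubleLaurent W}
    (h : ∀ n w, Laurent.map (fieldCoeff n w) (expSubst B) =
      Laurent.map (fieldCoeff n w) (expSubst B')) : B = B' := by
  refine LinearMap.ext fun w => Subtype.ext (funext fun m => funext fun n => ?_)
  have fin : ∀ (C : DoubleLaurent W) (c : ℤ → ℂ),
      (Function.support fun k : ℤ => c k • C.1 k (m + n - k)).Finite := fun C c =>
    DoubleLaurent.finite_support C.2 c (m + n)
  -- In total degree `m + n`, the coefficients of `z ^ j` are the moments, divided by `j!`.
  have hX : (Function.support fun k : ℤ => (B w - B' w).1 k (m + n - k)).Finite := by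
    simpa only [one_smul] using fin (B w - B' w) fun _ => 1
  have h0 := eq_zero_of_moments hX fun j => by
    have hj := congrArg (fun A => (j.factorial : ℂ) • Laurent.coeff A j) (h (m + n) w)
    simp only [coeff_map_expSubst, smul_finsum, smul_smul] at hj
    rw [← sub_eq_zero, ← finsum_sub_distrib (fin _ _) (fin _ _)] at hj
    refine Eq.trans (finsum_congr fun k => ?_) hj
    rw [← smul_sub, mul_div_cancel₀ _ (by exact_mod_cast j.factorial_ne_zero)]
    rfl
  have h1 := congrFun h0 m
  rw [add_sub_cancel_left] at h1
  exact sub_eq_zero.1 h1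

/-! ### Multiplication by functions of `x₁ / x₂` -/

theorem mulPoly_mul (p q : Polynomial ℂ) (A : ℤ → ℤ → W) :
    mulPoly (p * q) A = mulPoly p (mulPoly q A) := by
  simp [mulPoly]

theorem mulPoly_C_mul_X_pow (c : ℂ) (k : ℕ) (A : ℤ → ℤ → W) :
    mulPoly (Polynomial.C c * Polynomial.X ^ k) A = c • (mulRatio ^ k) A := by
  simp [mulPoly, Algebra.algebraMap_eq_smul_one]

theorem mulRatio_pow_swap (k : ℕ) (A : ℤ → ℤ → W) :
    (mulRatio ^ k) (swap ((mulRatio ^ k) A)) = swap A := by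
  induction k generalizing A with
  | zero => rfl
  | succ k ih =>
    rw [pow_succ']
    change mulRatio ((mulRatio ^ k) (swap (mulRatio ((mulRatio ^ k) A)))) = _
    have e : mulRatio ((mulRatio ^ k) A) = (mulRatio ^ k) (mulRatio A) := by
      rw [← Module.End.mul_apply, ← Module.End.mul_apply, ← pow_succ', pow_succ]
    rw [e, ih]
    funext m n
    change A (n + 1 - 1) (m - 1 + 1) = A n m
    rw [add_sub_cancel_right, sub_add_cancel]

/-- `q^*(x₁ / x₂) A = (x₁ / x₂) ^ d q(x₂ / x₁) A`. -/
theorem mulPoly_reflect_swap {q : Polynomial ℂ} {d : ℕ} (hd : q.natDegree ≤ d) (A : ℤ → ℤ → W) :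
    mulPoly (q.reflect d) (swap A) = mulPoly (Polynomial.X ^ d) (swap (mulPoly q A)) := by
  have e : ∀ p q : Polynomial ℂ, ∀ A : ℤ → ℤ → W,
    mulPoly (p + q) A = mulPoly p A + mulPoly q A := fun p q A => by simp [mulPoly]
  refine Polynomial.induction_with_natDegree_le
    (fun q => mulPoly (q.reflect d) (swap A) = mulPoly (Polynomial.X ^ d) (swap (mulPoly q A))) d
    ?_ ?_ ?_ q hd
  · simp only [Polynomial.reflect_zero, mulPoly, map_zero]
    exact (map_zero (mulPoly (W := W) (Polynomial.X ^ d))).symm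
  · intro k c _ hk
    have e' := mulPoly_C_mul_X_pow (W := W) 1 d (swap (c • (mulRatio ^ k) A))
    rw [Polynomial.C_1, one_mul, one_smul] at e'
    rw [Polynomial.reflect_C_mul_X_pow, Polynomial.revAt_le hk, mulPoly_C_mul_X_pow,
      mulPoly_C_mul_X_pow, e']
    change _ = (mulRatio ^ d) (c • swap ((mulRatio ^ k) A))
    rw [map_smul]
    congr 1
    obtain ⟨l, rfl⟩ := Nat.exists_eq_add_of_le' hk
    rw [Nat.add_sub_cancel, pow_add, Module.End.mul_apply, mulRatio_pow_swap]
  · intro f g _ _ hf hg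
    rw [Polynomial.reflect_add, e, hf, hg, e, ← map_add]
    rfl

/-- `p(r) ∈ ℂ((r))` for a polynomial `p`. -/
def polyLaurent (p : Polynomial ℂ) : LaurentSeries ℂ :=
  p.eval₂ HahnSeries.C (HahnSeries.single 1 1)

/-- `L ∈ W((r))` is the part of total degree `N` of `A`, under `x₁ ^ m x₂ ^ (N - m) ↦ r ^ m`. -/
def IsDiagonal (N : ℤ) (A : ℤ → ℤ → W) (L : Laurent W) : Prop := ∀ m, L.coeff m = A m (N - m)

/-- Multiplication by `p(x₁ / x₂)` preserves the total degree, and is multiplication by `p(r)` in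
each of them. -/
theorem IsDiagonal.polyLaurent_smul (p : Polynomial ℂ) : ∀ {N : ℤ} {A : ℤ → ℤ → W} {L : Laurent W},
    IsDiagonal N A L → IsDiagonal N (mulPoly p A) (polyLaurent p • L) := by
  induction p using Polynomial.induction_on with
  | C c =>
    intro N A L h m
    rw [polyLaurent, Polynomial.eval₂_C, HahnSeries.C_apply, HahnModule.single_zero_smul_eq_smul]
    change c • L.coeff m = _
    rw [h]
    simp [mulPoly, Algebra.algebraMap_eq_smul_one]
  | add p q hp hq =>
    intro N A L h m
    rw [polyLaurent, Polynomial.eval₂_add, add_smul, Laurent.coeff_add]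
    refine (congrArg₂ (· + ·) (hp h m) (hq h m)).trans ?_
    simp [mulPoly]
  | monomial n c ih =>
    intro N A L h m
    have h1 : IsDiagonal N (mulRatio A) ((HahnSeries.single 1 1 : LaurentSeries ℂ) • L) := by
      intro m
      rw [Laurent.coeff_single_one_smul, h]
      change _ = A (m - 1) (N - m + 1)
      congr 1
      ring
    rw [pow_succ, ← mul_assoc, polyLaurent, Polynomial.eval₂_mul_X, laurent_mul_smul]
    refine (ih h1 m).trans ?_
    have e : mulPoly Polynomial.X A = mulRatio A := by rw [mulPoly, Polynomial.aeval_X]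
    rw [← e, ← mulPoly_mul]

theorem IsDiagonal.smul (g : LaurentSeries ℂ) {N : ℤ} {A : ℤ → ℤ → W} {L : Laurent W}
    (h : IsDiagonal N A L) : IsDiagonal N (mulSeries (ratioSeries g) A) (g • L) := by
  intro m
  rw [Laurent.coeff_smul, mulSeries]
  have hinj : Function.Injective fun s : ℤ => (s, -s) := fun s t hst => (Prod.ext_iff.1 hst).1
  have e := finsum_mem_range hinj
    (f := fun s : ℤ × ℤ => ratioSeries g s.1 s.2 • A (m - s.1) (N - m - s.2))
  rw [finsum_mem_inter_support_eq _ _ Set.univ, finsum_mem_univ] at e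
  · rw [e]
    refine finsum_congr fun s => ?_
    rw [ratioSeries, if_pos (add_neg_cancel s), h]
    congr 2
    ring
  · rw [Set.univ_inter, Set.inter_eq_right]
    rintro ⟨s, t⟩ hst
    refine ⟨s, Prod.ext rfl ?_⟩
    by_contra hne
    refine hst ?_
    change ratioSeries g s t • _ = _
    rw [ratioSeries, if_neg (fun h0 => hne (by change -s = t; omega)), zero_smul]

theorem exists_isDiagonal_swap_prodSeries (a b : Fields W) (w : W) (N : ℤ) :
    ∃ L, IsDiagonal N (swap (prodSeries b a w)) L := by
  obtain ⟨M, hM⟩ := coeff_field_eq_zero a w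
  refine ⟨HahnModule.of ℂ (HahnSeries.ofSuppBddBelow
    (fun m => swap (prodSeries b a w) m (N - m)) ⟨M, fun m hm => ?_⟩), fun m => rfl⟩
  by_contra h
  refine hm ?_
  change HVertexOperator.coeff b (N - m) (HVertexOperator.coeff a m w) = 0
  rw [hM m (not_le.1 h), map_zero]

/-- `p(x₁ / x₂) g(x₁ / x₂) A = q(x₁ / x₂) A` if `p g = q`. -/
theorem mulPoly_mulSeries_ratioSeries {p q : Polynomial ℂ} {g : LaurentSeries ℂ}
    (h : polyLaurent p * g = polyLaurent q) {A : ℤ → ℤ → W} (hA : ∀ N, ∃ L, IsDiagonal N A L) :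
    mulPoly p (mulSeries (ratioSeries g) A) = mulPoly q A := by
  funext m n
  obtain ⟨L, hL⟩ := hA (m + n)
  have h1 := ((hL.smul g).polyLaurent_smul p) m
  rw [← laurent_mul_smul, h, (hL.polyLaurent_smul q) m, add_sub_cancel_left] at h1
  exact h1.symm

/-! ### Values of rational functions -/

theorem eval₂_single_ne_zero {a : ℤ} (ha : a ≠ 0) {p : Polynomial ℂ} (hp : p ≠ 0) :
    p.eval₂ HahnSeries.C (HahnSeries.single a 1 : LaurentSeries ℂ) ≠ 0 := by
  obtain ⟨n, hn⟩ := Polynomial.support_nonempty.2 hp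
  intro h
  have h1 := congrArg (fun f => HahnSeries.coeff f (n * a)) h
  simp only [Polynomial.eval₂_eq_sum, Polynomial.sum, HahnSeries.coeff_sum, HahnSeries.single_pow,
    HahnSeries.C_mul_eq_smul, HahnSeries.coeff_smul, HahnSeries.coeff_zero, one_pow] at h1
  rw [Finset.sum_eq_single_of_mem n hn] at h1
  · rw [nsmul_eq_mul, HahnSeries.coeff_single_same, smul_eq_mul, mul_one] at h1
    exact Polynomial.mem_support_iff.1 hn h1
  · intro k _ hk
    rw [nsmul_eq_mul, HahnSeries.coeff_single_of_ne, smul_zero]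
    intro h0
    exact hk (by exact_mod_cast (mul_right_cancel₀ ha h0).symm)

/-- If `p f = q`, then `p(e ^ z) f(e ^ z) = q(e ^ z)`. -/
theorem polyExp_mul_ratSubst {p q : Polynomial ℂ} {f : RatFunc ℂ} (h : p * f.num = q * f.denom) :
    polyExp p * ratSubst f expL = polyExp q := by
  have h1 := congrArg polyExp h
  rw [polyExp, polyExp, Polynomial.eval₂_mul, Polynomial.eval₂_mul] at h1
  rw [ratSubst, RatFunc.eval, ← mul_div_assoc]
  exact (div_eq_iff (polyExp_ne_zero f.denom_ne_zero)).2 h1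

/-- For a rational function `f` there is one, namely `f(x⁻¹)`, whose value at `r⁻¹` is `f(r)`.
The latter is expressed by: if `p f = q`, then `p(r)` times that value is `q(r)`. -/
theorem exists_ratSubst_inv (f : RatFunc ℂ) : ∃ f' : RatFunc ℂ, ∀ p q : Polynomial ℂ,
    p * f.num = q * f.denom →
      polyLaurent p * ratSubst f' (HahnSeries.single (-1) 1) = polyLaurent q := by
  set x : LaurentSeries ℂ := HahnSeries.single 1 1 with hx
  set y : LaurentSeries ℂ := HahnSeries.single (-1) 1 with hy
  have hxy : x * y = 1 := by
    rw [hx, hy, HahnSeries.single_mul_single, mul_one]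
    rfl
  let _ : Invertible x := ⟨y, by rw [mul_comm, hxy], hxy⟩
  -- `f'` is written with the reflected numerator and denominator, both reflected in the same
  -- degree `D`.
  set D := max f.num.natDegree f.denom.natDegree with hD
  set f' : RatFunc ℂ := algebraMap _ _ (f.num.reflect D) / algebraMap _ _ (f.denom.reflect D)
    with hf'
  have hd0 : f.denom.reflect D ≠ 0 := fun h => f.denom_ne_zero (Polynomial.reflect_eq_zero_iff.1 h)
  have h1 : f'.num * f.denom.reflect D = f.num.reflect D * f'.denom := by
    have h2 : (algebraMap (Polynomial ℂ) (RatFunc ℂ) f'.num) / algebraMap _ _ f'.denom = f' :=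
      RatFunc.num_div_denom f'
    rw [hf', div_eq_div_iff (RatFunc.algebraMap_ne_zero (RatFunc.denom_ne_zero _))
      (RatFunc.algebraMap_ne_zero hd0), ← map_mul, ← map_mul] at h2
    exact RatFunc.algebraMap_injective ℂ h2
  have h3 := congrArg (Polynomial.eval₂ (HahnSeries.C : ℂ →+* LaurentSeries ℂ) y) h1
  rw [Polynomial.eval₂_mul, Polynomial.eval₂_mul] at h3
  have hden : Polynomial.eval₂ (HahnSeries.C : ℂ →+* LaurentSeries ℂ) y f'.denom ≠ 0 :=
    eval₂_single_ne_zero (by norm_num) (RatFunc.denom_ne_zero _)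
  have h4 : polyLaurent f.num = Polynomial.eval₂ HahnSeries.C y (f.num.reflect D) * x ^ D :=
    (Polynomial.eval₂_reflect_mul_pow _ x D f.num (le_max_left _ _)).symm
  have h5 : polyLaurent f.denom = Polynomial.eval₂ HahnSeries.C y (f.denom.reflect D) * x ^ D :=
    (Polynomial.eval₂_reflect_mul_pow _ x D f.denom (le_max_right _ _)).symm
  have h6 : ratSubst f' y * polyLaurent f.denom = polyLaurent f.num := by
    rw [h4, h5, ratSubst, RatFunc.eval, div_mul_eq_mul_div, div_eq_iff hden, ← mul_assoc, h3]
    ring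
  refine ⟨f', fun p q h => ?_⟩
  have h7 := congrArg polyLaurent h
  rw [polyLaurent, polyLaurent, Polynomial.eval₂_mul, Polynomial.eval₂_mul] at h7
  change polyLaurent p * polyLaurent f.num = polyLaurent q * polyLaurent f.denom at h7
  refine mul_right_cancel₀ (eval₂_single_ne_zero one_ne_zero f.denom_ne_zero) ?_
  change _ * polyLaurent f.denom = _ * polyLaurent f.denom
  rw [mul_assoc, h6, h7]

end ExpSubst

/-! ### Homomorphic images -/

section Image

variable {U V W : Type*} [AddCommGroup U] [Module ℂ U] [AddCommGroup V] [Module ℂ V]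
  [AddCommGroup W] [Module ℂ W]

theorem Laurent.map_add (g : U →ₗ[ℂ] V) (A B : Laurent U) :
    Laurent.map g (A + B) = Laurent.map g A + Laurent.map g B :=
  Laurent.ext fun n => _root_.map_add g (A.coeff n) (B.coeff n)

theorem Laurent.map_const_smul (g : U →ₗ[ℂ] V) (c : ℂ) (A : Laurent U) :
    Laurent.map g (c • A) = c • Laurent.map g A :=
  Laurent.ext fun n => _root_.map_smul g c (A.coeff n)

theorem Laurent.map_single_zero (g : U →ₗ[ℂ] V) (u : U) :
    Laurent.map g (HahnModule.of ℂ (HahnSeries.single 0 u)) =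
      HahnModule.of ℂ (HahnSeries.single 0 (g u)) := by
  refine Laurent.ext fun n => ?_
  change g ((HahnSeries.single 0 u).coeff n) = (HahnSeries.single 0 (g u)).coeff n
  by_cases h : n = 0
  · rw [h, HahnSeries.coeff_single_same, HahnSeries.coeff_single_same]
  · rw [HahnSeries.coeff_single_of_ne h, HahnSeries.coeff_single_of_ne h, map_zero]

/-- The `𝒮`-Jacobi identity passes to homomorphic images. -/
theorem SJacobi.map {Y : V →ₗ[ℂ] Fields V} {Z : U →ₗ[ℂ] Fields U} {g : V →ₗ[ℂ] U}
    (hg : Function.Surjective g) (hZ : ∀ u v, Z (g u) (g v) = Laurent.map g (Y u v)) {u v : V}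
    {r : ℕ} {u' v' : Fin r → V} {f : Fin r → LaurentSeries ℂ} (h : SJacobi Y u v u' v' f) :
    SJacobi Z (g u) (g v) (g ∘ u') (g ∘ v') f := by
  intro w n p q
  obtain ⟨w, rfl⟩ := hg w
  have hc : ∀ a m x, HVertexOperator.coeff (Z (g a)) m (g x) =
      g (HVertexOperator.coeff (Y a) m x) := fun a m x =>
    congrArg (fun L => Laurent.coeff L m) (hZ a x)
  have hP : ∀ a b, prodSeries (Z (g a)) (Z (g b)) (g w) =
      fun m n => g (prodSeries (Y a) (Y b) w m n) := fun a b => by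
    funext m n
    change HVertexOperator.coeff (Z (g a)) m (HVertexOperator.coeff (Z (g b)) n (g w)) = _
    rw [hc, hc]
    rfl
  have hmul : ∀ (c : LaurentSeries ℂ) (P : ℤ → ℤ → V), P ∈ IteratedLaurent V →
      mulSeries (iotaDiff c) (fun m n => g (P m n)) =
        fun m n => g (mulSeries (iotaDiff c) P m n) := fun c P hP => by
    funext m n
    exact (map_mulSeries g _ P m n (finite_support_iotaDiff c hP m n)).symm
  have hS : (∑ i, mulSeries (iotaDiff (f i)) (prodSeries (Y (v' i)) (Y (u' i)) w)) ∈
      IteratedLaurent V :=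
    Submodule.sum_mem _ fun i _ => mulSeries_iotaDiff_mem _ (prodSeries_mem _ _ _)
  have hsum : (∑ i, mulSeries (iotaDiff (f i))
      (prodSeries (Z ((g ∘ v') i)) (Z ((g ∘ u') i)) (g w))) = fun m n =>
        g ((∑ i, mulSeries (iotaDiff (f i)) (prodSeries (Y (v' i)) (Y (u' i)) w)) m n) := by
    funext m n
    simp only [Finset.sum_apply, _root_.map_sum, Function.comp_apply]
    refine Finset.sum_congr rfl fun i _ => ?_
    rw [hP, hmul _ _ (prodSeries_mem _ _ _)]
  have hJ := congrArg g (h w n p q)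
  rw [map_sub, _root_.map_smul] at hJ
  rw [hP, hmul _ _ (prodSeries_mem _ _ _), hsum, hmul _ _ hS, hJ]
  refine (AddMonoidHom.map_finsum g.toAddMonoidHom ?_).trans (finsum_congr fun s => ?_)
  · obtain ⟨N, hN⟩ := Laurent.exists_lower_bound (Y u v)
    refine ((Set.finite_Icc 0 (-n - 1 - N)).image fun i : ℤ => (p + i, i)).subset ?_
    rintro ⟨k, i⟩ hki
    have h1 : p + i = k := by
      by_contra h1
      exact hki (by simp [iotaDiff_eq_zero _ (HahnSeries.coeff_single_of_ne h1)])
    refine ⟨i, Set.mem_Icc.2 ⟨?_, ?_⟩, Prod.ext h1 rfl⟩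
    · by_contra h2
      exact hki (by simp [iotaDiff_of_neg _ p (not_le.1 h2)])
    · by_contra h2
      exact hki (by simp [hN (-n - 1 - i) (by omega)])
  · change g (_ • _) = _
    rw [_root_.map_smul, hZ, Laurent.coeff_map, hc]

/-- A linear surjection `g` transports the structure of a weak quantum vertex algebra if
`g(Y(u, x) v)` depends only on `g u` and `g v`. -/
theorem WeakQVA.exists_of_surjective (A : WeakQVA V) {g : V →ₗ[ℂ] U} (hg : Function.Surjective g)
    (h : ∀ u₁ u₂ v₁ v₂, g u₁ = g u₂ → g v₁ = g v₂ →
      Laurent.map g (A.Y u₁ v₁) = Laurent.map g (A.Y u₂ v₂)) :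
    ∃ B : WeakQVA U, A.IsHom B g := by
  choose s hs using hg
  let Z : U →ₗ[ℂ] Fields U :=
    { toFun a :=
        { toFun b := Laurent.map g (A.Y (s a) (s b))
          map_add' b c := by
            rw [← Laurent.map_add, ← _root_.map_add]
            exact h _ _ _ _ rfl (by simp only [_root_.map_add, hs])
          map_smul' t b := by
            rw [RingHom.id_apply, ← Laurent.map_const_smul, ← _root_.map_smul]
            exact h _ _ _ _ rfl (by simp only [_root_.map_smul, hs]) }
      map_add' a b := LinearMap.ext fun c => by
        change _ = Laurent.map g _ + Laurent.map g _
        rw [← Laurent.map_add, ← LinearMap.add_apply, ← _root_.map_add]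
        exact h _ _ _ _ (by simp only [_root_.map_add, hs]) rfl
      map_smul' t a := LinearMap.ext fun c => by
        change _ = t • Laurent.map g _
        rw [← Laurent.map_const_smul, ← LinearMap.smul_apply, ← _root_.map_smul]
        exact h _ _ _ _ (by simp only [_root_.map_smul, hs]) rfl }
  have hZ : ∀ u v, Z (g u) (g v) = Laurent.map g (A.Y u v) := fun u v =>
    h _ _ _ _ (hs _) (hs _)
  refine ⟨⟨Z, g A.vac, fun a => ?_, fun a n hn => ?_, fun a => ?_, fun a b => ?_⟩, rfl,
    fun u v => (hZ u v).symm⟩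
  · rw [← hs a, hZ, A.vac_left, Laurent.map_single_zero]
  · rw [← hs a, hZ, Laurent.coeff_map, A.creation _ n hn, map_zero]
  · rw [← hs a, hZ, Laurent.coeff_map, A.creation_lim]
  · obtain ⟨r, u', v', f, hJ⟩ := A.jacobi (s a) (s b)
    refine ⟨r, g ∘ u', g ∘ v', f, ?_⟩
    rw [← hs a, ← hs b]
    exact hJ.map (fun a => ⟨s a, hs a⟩) hZ

end Image

/-! ### Quasi modules -/

section Module

variable {V W : Type*} [AddCommGroup V] [Module ℂ V] [AddCommGroup W] [Module ℂ W]
  {A : WeakQVA V}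

theorem PhiQuasiModule.map_YW (M : PhiQuasiModule A W) (u v : V) :
    Laurent.map M.YW (A.Y u v) = YE (M.YW u) (M.YW v) := by
  obtain ⟨p, hp, h, e⟩ := M.assoc u v
  rw [YE_eq _ _ p hp h, ← e, ← laurent_mul_smul, inv_mul_cancel₀ (polyExp_ne_zero hp), one_smul]

theorem PhiQuasiModule.expSubst_quasiProd (M : PhiQuasiModule A W) {u v : V} {p : Polynomial ℂ}
    (hp : p ≠ 0) (h : QuasiCompatible p (M.YW u) (M.YW v)) :
    expSubst (quasiProd p (M.YW u) (M.YW v) h) = polyExp p • Laurent.map M.YW (A.Y u v) := by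
  rw [M.map_YW, YE_eq _ _ p hp h, ← laurent_mul_smul, mul_inv_cancel₀ (polyExp_ne_zero hp),
    one_smul]

theorem coeff_idField (n : ℤ) (w : W) :
    HVertexOperator.coeff (idField W) n w = if n = 0 then w else 0 := by
  change (if n = 0 then (LinearMap.id : W →ₗ[ℂ] W) else 0) w = _
  split_ifs <;> rfl

/-- `Y_W(Y(a, z) 1, x) = Y_W(a, x e ^ z)`, for the coefficient of `x ^ n`. -/
theorem PhiQuasiModule.fieldCoeff_YW_coeff_vac (M : PhiQuasiModule A W) (n : ℤ) (w : W) (a : V)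
    (l : ℕ) : (fieldCoeff n w ∘ₗ M.YW) (Laurent.coeff (A.Y a A.vac) l) =
      ((n : ℂ) ^ l / (l.factorial : ℂ)) • (fieldCoeff n w ∘ₗ M.YW) a := by
  have hprod : ∀ w m n, mulPoly 1 (prodSeries (M.YW a) (M.YW A.vac) w) m n =
      if n = 0 then HVertexOperator.coeff (M.YW a) m w else 0 := by
    intro w m n
    rw [mulPoly, map_one, Module.End.one_apply, M.YW_vac]
    change HVertexOperator.coeff (M.YW a) m (HVertexOperator.coeff (idField W) n w) = _
    rw [coeff_idField]
    split_ifs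
    · rfl
    · exact map_zero _
  have h1 : QuasiCompatible 1 (M.YW a) (M.YW A.vac) := by
    intro w
    obtain ⟨N, hN⟩ := coeff_field_eq_zero (M.YW a) w
    refine ⟨min N 0, fun m n h => ?_⟩
    rw [hprod]
    split_ifs with h0
    · exact hN m (by omega)
    · rfl
  have h2 := M.expSubst_quasiProd one_ne_zero h1
  rw [polyExp, Polynomial.eval₂_one, one_smul] at h2
  have h3 := coeff_map_expSubst (quasiProd 1 (M.YW a) (M.YW A.vac) h1) n w l
  rw [h2] at h3
  refine h3.trans ?_
  rw [finsum_eq_single _ n]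
  · congr 1
    refine (hprod w n (n - n)).trans ?_
    rw [sub_self, if_pos rfl]
    rfl
  · intro m hm
    have : (quasiProd 1 (M.YW a) (M.YW A.vac) h1 w).1 m (n - m) = 0 :=
      (hprod w m (n - m)).trans (if_neg (by omega))
    rw [this, smul_zero]

theorem polyExp_mul (p q : Polynomial ℂ) : polyExp (p * q) = polyExp p * polyExp q :=
  Polynomial.eval₂_mul _ _

/-- Quasi locality of the fields of a quasi module: both sides, multiplied by a suitable polynomial
in `x₁ / x₂`, are in `Hom(W, W((x₁, x₂)))`, and by skew symmetry they agree at `x₁ = x₂ e ^ z`. -/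
theorem PhiQuasiModule.isQuasiSTrigLocal (M : PhiQuasiModule A W) (hT : A.IsTType) :
    IsQuasiSTrigLocal (M.fieldSpace : Set (Fields W)) := by
  classical
  rintro _ ⟨u, rfl⟩ _ ⟨v, rfl⟩
  obtain ⟨r, u', v', f, k, hloc⟩ := hT u v
  obtain ⟨p₀, hp₀, hc₀, -⟩ := M.assoc u v
  choose q hq hc _ using fun i => M.assoc (v' i) (u' i)
  choose f' hf' using fun i => exists_ratSubst_inv (f i)
  set e : Fin r → Polynomial ℂ := fun i => (f i).denom * (q i).reflect (q i).natDegree with he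
  have he0 : ∀ i, e i ≠ 0 := fun i =>
    mul_ne_zero (f i).denom_ne_zero fun h => hq i (Polynomial.reflect_eq_zero_iff.1 h)
  -- `p` clears the denominators of the `f i` and makes all products of fields quasi compatible.
  set p := p₀ * ∏ i, e i with hp
  have hp0 : p ≠ 0 := mul_ne_zero hp₀ (Finset.prod_ne_zero_iff.2 fun i _ => he0 i)
  set t : Fin r → Polynomial ℂ := fun i => p₀ * (f i).num * ∏ j ∈ Finset.univ.erase i, e j with ht
  have hpt : ∀ i, p * (f i).num = (t i * (q i).reflect (q i).natDegree) * (f i).denom := by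
    intro i
    rw [hp, ← Finset.mul_prod_erase _ e (Finset.mem_univ i)]
    simp only [ht, he]
    ring
  have hcp : QuasiCompatible p (M.YW u) (M.YW v) := fun w => by
    rw [hp, mul_comm, mulPoly_mul]
    exact mulPoly_mem _ _ (hc₀ w)
  -- `S i` is `q_i(x₂ / x₁) Y_W(v_i, x₂) Y_W(u_i, x₁)`, and `R i`, its multiple by
  -- `t_i(x₁ / x₂) (x₁ / x₂) ^ deg q_i`, is `p(x₁ / x₂) f_i(x₁ / x₂) Y_W(v_i, x₂) Y_W(u_i, x₁)`.
  let S : Fin r → W →ₗ[ℂ] DoubleLaurent W := fun i =>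
    { toFun w := ⟨swap (quasiProd (q i) _ _ (hc i) w).1, by
        obtain ⟨N, hN⟩ := (quasiProd (q i) _ _ (hc i) w).2
        exact ⟨N, fun m n h => hN n m h.symm⟩⟩
      map_add' w w' := by
        rw [map_add]
        rfl
      map_smul' c w := by
        rw [map_smul]
        rfl }
  let R : Fin r → W →ₗ[ℂ] DoubleLaurent W := fun i =>
    ((mulPoly (t i * Polynomial.X ^ (q i).natDegree)).comp
      ((DoubleLaurent W).subtype.comp (S i))).codRestrict _ fun w => mulPoly_mem _ _ (S i w).2
  have hR : ∀ i w, (R i w).1 = mulPoly p (mulSeries (iotaRatio (f' i))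
      (swap (prodSeries (M.YW (v' i)) (M.YW (u' i)) w))) := by
    intro i w
    rw [iotaRatio, mulPoly_mulSeries_ratioSeries (hf' i _ _ (hpt i))
      (exists_isDiagonal_swap_prodSeries _ _ w), mulPoly_mul, mulPoly_reflect_swap le_rfl,
      ← mulPoly_mul]
    rfl
  have key : quasiProd p (M.YW u) (M.YW v) hcp = ∑ i, R i := by
    refine eq_of_map_expSubst fun n w => ?_
    rw [expSubst_sum, Laurent.map_sum, M.expSubst_quasiProd hp0, Laurent.map_smul, Laurent.map_map,
      skew_symmetry A (hloc A.vac) _ (n : ℂ) (M.fieldCoeff_YW_coeff_vac n w), Finset.smul_sum]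
    refine Finset.sum_congr rfl fun i _ => ?_
    rw [expSubst_mulPoly (t i * Polynomial.X ^ (q i).natDegree) (S i) (R i) fun _ => rfl,
      Laurent.map_smul, map_expSubst_swap (B := quasiProd (q i) _ _ (hc i)) (B' := S i)
        (fun _ => rfl), M.expSubst_quasiProd (hq i), Laurent.map_smul, Laurent.neg_smul,
      ← laurent_mul_smul, ← laurent_mul_smul, ← laurent_mul_smul, Laurent.map_map]
    congr 1
    have hX : polyExp (Polynomial.X ^ (q i).natDegree) = expL ^ (q i).natDegree := by
      rw [polyExp, Polynomial.eval₂_X_pow]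
    rw [← mul_assoc, polyExp_mul_ratSubst (hpt i), polyExp_mul (t i), polyExp_mul (t i),
      polyExp_reflect _ le_rfl, hX]
    ring
  refine ⟨r, fun i => M.YW (u' i), fun i => M.YW (v' i), f', p, fun i => ⟨_, rfl⟩,
    fun i => ⟨_, rfl⟩, hp0, fun w => ?_⟩
  have h1 := congrArg (fun B : W →ₗ[ℂ] DoubleLaurent W => (B w).1) key
  refine h1.trans ?_
  rw [_root_.map_sum, LinearMap.sum_apply, Submodule.coe_sum]
  exact Finset.sum_congr rfl fun i _ => hR i w

end Module

end QVA

end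

theorem proposition4p10 {V W : Type*} [AddCommGroup V] [Module ℂ V] [AddCommGroup W] [Module ℂ W]
    (A : QVA.WeakQVA V) (hT : A.IsTType) (M : QVA.PhiQuasiModule A W) :
    QVA.IsQuasiSTrigLocal (M.fieldSpace : Set (QVA.Fields W)) ∧
    ∃ B : QVA.WeakQVA M.fieldSpace,
      (∀ a b : M.fieldSpace,
        QVA.Laurent.map M.fieldSpace.subtype (B.Y a b) = QVA.YE (a : QVA.Fields W) b) ∧
      (B.vac : QVA.Fields W) = QVA.idField W ∧
      A.IsHom B M.YW.rangeRestrict := by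
  have hmap : ∀ u v, QVA.Laurent.map M.fieldSpace.subtype
      (QVA.Laurent.map (V := M.fieldSpace) M.YW.rangeRestrict (A.Y u v)) =
        QVA.YE (M.YW u) (M.YW v) := by
    intro u v
    exact M.map_YW u v
  refine ⟨M.isQuasiSTrigLocal hT, ?_⟩
  obtain ⟨B, hB⟩ := A.exists_of_surjective (U := M.fieldSpace)
    (g := M.YW.rangeRestrict) M.YW.surjective_rangeRestrict
    fun u₁ u₂ v₁ v₂ hu hv => by
      refine QVA.Laurent.map_injective (U := M.fieldSpace) M.fieldSpace.injective_subtype ?_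
      rw [hmap, hmap]
      exact congrArg₂ _ (congrArg Subtype.val hu) (congrArg Subtype.val hv)
  refine ⟨B, ?_, ?_, hB⟩
  · intro a b
    obtain ⟨u, rfl⟩ := M.YW.surjective_rangeRestrict a
    obtain ⟨v, rfl⟩ := M.YW.surjective_rangeRestrict b
    rw [← hB.2, hmap]
    rfl
  · rw [← hB.1]
    exact M.YW_vac
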